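/- Let $A$ be a finite set and let $\alpha,\beta$ be strict subsets of $A$ with $\alpha\cup\beta=A$ and $\alpha\cap\beta\neq\emptyset$. Let $\rho'=(\alpha\times\alpha\times\alpha)\cup(\beta\times\beta\times\beta)$ and, for $k\in\mathbb N$, let $\tau_k$ be the $3k$-ary relation on $A$ \[\tau_k(x_1,y_1,z_1,\ldots,x_k,y_k,z_k):=\rho'(x_1,y_1,z_1)\vee\ldots\vee\rho'(x_k,y_k,z_k).\] An instance of $\mathrm{QCSP}(A;\{\tau_k:k\in\mathbb N\},\text{constants})$ is a prenex positive Horn sentence $Q_1v_1\ldots Q_nv_n\,\bigwedge_j\psi_j$, $Q_i\in\{\forall,\exists\}$, in which each atom $\psi_j$ is an equality $t=t'$ or has the form $R(t_1,\ldots,t_r)$; the terms are variables $v_i$ and constants naming the elements of $A$, and each relation $R$ is given in the input by a quantifier-free formula over equality with constants in $r$ variables that defines it. The yes-instances are the sentences all of whose relations are among the $\tau_k$ and which are true over $A$. Then: 1. $\mathrm{QCSP}(A;\{\tau_k:k\in\mathbb N\},\text{constants})$ is in co-NP. 2. (Elimination of constant atoms.) Let $\phi$ be such a sentence over the relations $\tau_k$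 without equalities between two variables. Let $\phi^*$ arise from $\phi$ by replacing every existential variable $v$ that occurs in an atom $v=a$ or $a=v$ ($a\in A$ a constant) by the constant $a$ of the first such atom, and then deleting all atoms $a=a$ with $a$ a constant. Then $\phi^*$ is again a sentence over the relations $\tau_k$, and $\phi$ is true if and only if $\phi^*$ contains no equality atoms and is true. 3. (Instantiation.) Let $\phi$ be such a sentence over the relations $\tau_k$ without equality atoms. For every $c\in\alpha\cap\beta$, $\phi$ is true if and only if the universal sentence obtained from $\phi$ by setting all existential variables to $c$ is true. -/

import Mathlib

namespace PH

/-! ### Membership in NP and co-NP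

Time is the number of steps of Mathlib's multi-stack Turing machines `Turing.FinTM2`. -/

/-- The code of a pair (instance, certificate): the code of the instance followed by the
certificate, written over the disjoint union of the two alphabets. -/
def encodeWithCert {X G D : Type} (enc : X → List G) (w : X × List D) : List (G ⊕ D) :=
  (enc w.1).map Sum.inl ++ w.2.map Sum.inr

/-- The decision problem `P`, whose instances are coded by `enc`, is in NP: there is a verifier
running in polynomial time such that the yes-instances are exactly those that have
an accepted certificate of polynomial length. -/
def InNP {X G : Type} (enc : X → List G) (P : X → Prop) : Prop :=
  ∃ (D : Type) (_ : Finite D) (V : X × List D → Bool) (p : Polynomial ℕ),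
    Nonempty (Turing.TM2ComputableInPolyTime (encodeWithCert enc) Computability.encodeBool V) ∧
    ∀ x, P x ↔ ∃ c : List D, c.length ≤ p.eval (enc x).length ∧ V (x, c) = true

/-- A decision problem is in co-NP if its complement is in NP. -/
def InCoNP {X G : Type} (enc : X → List G) (P : X → Prop) : Prop :=
  InNP enc (fun x => ¬ P x)

/-! ### Positive Horn sentences -/

/-- Terms over `n` variables: a variable, or a constant naming an element of `A`. -/
inductive Term (A : Type) (n : ℕ) : Type
  | var (i : Fin n) : Term A n
  | const (a : A) : Term A n

/-- Quantifier-free formulas over equality with constants, in `r` variables. They are used to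
present `r`-ary relations. -/
inductive QF (A : Type) (r : ℕ) : Type
  | eq (s t : Term A r) : QF A r
  | neg (f : QF A r) : QF A r
  | and (f g : QF A r) : QF A r
  | or (f g : QF A r) : QF A r

/-- Atoms in `n` variables: an equality, or an `r`-ary relation, presented by a quantifier-free
formula, applied to `r` terms. -/
inductive Atom (A : Type) (n : ℕ) : Type
  | eq (s t : Term A n) : Atom A n
  | rel (r : ℕ) (f : QF A r) (args : Fin r → Term A n) : Atom A n

inductive Quant : Type
  | all : Quant
  | ex : Quant

/-- A prenex positive Horn sentence `Q₀ v₀ Q₁ v₁ … Q_{n-1} v_{n-1} (conjunction of atoms)`. -/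
structure Sentence (A : Type) : Type where
  numVars : ℕ
  quant : Fin numVars → Quant
  matrix : List (Atom A numVars)

variable {A : Type}

/-! ### Semantics -/

def Term.eval {n : ℕ} (x : Fin n → A) : Term A n → A
  | .var i => x i
  | .const a => a

def QF.Holds {r : ℕ} (x : Fin r → A) : QF A r → Prop
  | .eq s t => s.eval x = t.eval x
  | .neg f => ¬ f.Holds x
  | .and f g => f.Holds x ∧ g.Holds x
  | .or f g => f.Holds x ∨ g.Holds x

/-- The relation presented by a quantifier-free formula. -/
def QF.relation {r : ℕ} (f : QF A r) : Set (Fin r → A) := {x | f.Holds x}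

def Atom.Holds {n : ℕ} (x : Fin n → A) : Atom A n → Prop
  | .eq s t => s.eval x = t.eval x
  | .rel _ f args => (fun i => (args i).eval x) ∈ f.relation

/-- The truth value of `Q₀ v₀ … Q_{n-1} v_{n-1} P(v₀, …, v_{n-1})`. -/
def QuantHolds : (n : ℕ) → (Fin n → Quant) → ((Fin n → A) → Prop) → Prop
  | 0, _, P => P Fin.elim0
  | n + 1, q, P =>
    match q 0 with
    | .all => ∀ a : A, QuantHolds n (Fin.tail q) (fun x => P (Fin.cons a x))
    | .ex => ∃ a : A, QuantHolds n (Fin.tail q) (fun x => P (Fin.cons a x))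

/-- The sentence is true over the domain `A`. -/
def Sentence.IsTrue (φ : Sentence A) : Prop :=
  QuantHolds φ.numVars φ.quant (fun x => ∀ a ∈ φ.matrix, a.Holds x)

/-- All relations that occur in the sentence belong to `B`, a set of relations of any arities. -/
def Sentence.Over (B : Set (Σ r : ℕ, Set (Fin r → A))) (φ : Sentence A) : Prop :=
  ∀ (r : ℕ) (f : QF A r) (args : Fin r → Term A φ.numVars),
    Atom.rel r f args ∈ φ.matrix → (⟨r, f.relation⟩ : Σ r : ℕ, Set (Fin r → A)) ∈ B

/-- The problem `QCSP(A; B, constants)`: its yes-instances are the positive Horn sentences over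
`B`, equality and the constants that are true. -/
def QCSP (B : Set (Σ r : ℕ, Set (Fin r → A))) (φ : Sentence A) : Prop :=
  φ.Over B ∧ φ.IsTrue

/-! ### Encoding of sentences as words -/

/-- The alphabet; it is finite when `A` is. -/
inductive Tok (A : Type) : Type
  | all | ex | tick | var | eq | neg | and | or | rel | colon | close
  | const (a : A)

/-- A variable is written as its index in unary (at most the number of quantifiers of the
sentence, so that this costs no more than a polynomial factor). -/
def Term.encode {n : ℕ} : Term A n → List (Tok A)
  | .var i => List.replicate i.val .tick ++ [.var]
  | .const a => [.const a]

/-- Formulas are written in postfix (reverse Polish) notation. -/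
def QF.encode {r : ℕ} : QF A r → List (Tok A)
  | .eq s t => s.encode ++ t.encode ++ [.eq]
  | .neg f => f.encode ++ [.neg]
  | .and f g => f.encode ++ g.encode ++ [.and]
  | .or f g => f.encode ++ g.encode ++ [.or]

def Atom.encode {n : ℕ} : Atom A n → List (Tok A)
  | .eq s t => [.eq] ++ s.encode ++ t.encode
  | .rel _ f args =>
    [.rel] ++ (List.ofFn args).flatMap Term.encode ++ [.colon] ++ f.encode ++ [.close]

def Quant.encode : Quant → Tok A
  | .all => .all
  | .ex => .ex

def Sentence.encode (φ : Sentence A) : List (Tok A) :=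
  (List.ofFn φ.quant).map Quant.encode ++ φ.matrix.flatMap Atom.encode

/-! ### The relations `τ_k` -/

/-- `ρ'(x, y, z)`: the triple lies in `α × α × α ∪ β × β × β`. -/
def rho' (α β : Set A) (x y z : A) : Prop :=
  (x ∈ α ∧ y ∈ α ∧ z ∈ α) ∨ (x ∈ β ∧ y ∈ β ∧ z ∈ β)

/-- `τ_k(x₁, y₁, z₁, …, x_k, y_k, z_k) = ρ'(x₁, y₁, z₁) ∨ … ∨ ρ'(x_k, y_k, z_k)`, with the
coordinates in this order. -/
def tau (α β : Set A) (k : ℕ) : Set (Fin (3 * k) → A) :=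
  {x | ∃ i : Fin k, rho' α β (x ⟨3 * i.val, by omega⟩) (x ⟨3 * i.val + 1, by omega⟩)
    (x ⟨3 * i.val + 2, by omega⟩)}

/-- The set `{τ_k : k ∈ ℕ}`. -/
def tauLanguage (α β : Set A) : Set (Σ r : ℕ, Set (Fin r → A)) :=
  Set.range (fun k : ℕ => ⟨3 * k, tau α β k⟩)

/-! ### Elimination of constant atoms, and instantiation of the existential variables -/

def Term.subst {n : ℕ} (s : Fin n → Term A n) : Term A n → Term A n
  | .var i => s i
  | .const a => .const a

def Atom.subst {n : ℕ} (s : Fin n → Term A n) : Atom A n → Atom A n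
  | .eq t u => .eq (t.subst s) (u.subst s)
  | .rel r f args => .rel r f (fun i => (args i).subst s)

/-- Simultaneous substitution in the matrix. The quantifier prefix is kept; quantifiers of
variables that no longer occur are harmless. -/
def Sentence.subst (φ : Sentence A) (s : Fin φ.numVars → Term A φ.numVars) : Sentence A where
  numVars := φ.numVars
  quant := φ.quant
  matrix := φ.matrix.map (Atom.subst s)

/-- The atom is an equality between two variables. -/
def Atom.IsVarEq {n : ℕ} : Atom A n → Prop
  | .eq (.var _) (.var _) => True
  | _ => False

/-- The atom is an equality. -/
def Atom.IsEq {n : ℕ} : Atom A n → Prop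
  | .eq _ _ => True
  | .rel _ _ _ => False

/-- If the atom is `v = a` or `a = v` with a constant `a`, this is `some a`. -/
def Atom.constFor {n : ℕ} (v : Fin n) : Atom A n → Option A
  | .eq (.var w) (.const a) => if w = v then some a else none
  | .eq (.const a) (.var w) => if w = v then some a else none
  | _ => none

/-- What the elimination of constant atoms puts for the variable `v`: if `v` is existential and
occurs in an atom `v = a`, the constant `a` of the first such atom; otherwise `v` itself. -/
def Sentence.constSubst (φ : Sentence A) (v : Fin φ.numVars) : Term A φ.numVars :=
  match φ.quant v, φ.matrix.findSome? (Atom.constFor v) with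
  | .ex, some a => .const a
  | _, _ => .var v

/-- The atom is not of the form `a = a` with a constant `a`. -/
def Atom.nontrivial [DecidableEq A] {n : ℕ} : Atom A n → Bool
  | .eq (.const a) (.const b) => decide (a ≠ b)
  | _ => true

/-- Elimination of constant atoms: constants are substituted for the existential variables that
occur in atoms `v = a`, and then the atoms `a = a` are deleted. -/
def Sentence.elimConst [DecidableEq A] (φ : Sentence A) : Sentence A where
  numVars := φ.numVars
  quant := φ.quant
  matrix := (φ.subst φ.constSubst).matrix.filter Atom.nontrivial

/-- All existential variables are set to `c`, and all quantifiers become universal. -/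
def Sentence.instantiate (φ : Sentence A) (c : A) : Sentence A where
  numVars := φ.numVars
  quant := fun _ => .all
  matrix := (φ.subst fun v =>
    match φ.quant v with
    | .all => .var v
    | .ex => .const c).matrix

end PH

/-! Truth of a prenex sentence is the existence of a strategy that chooses each existential value
from the universal values before it and always satisfies the matrix (`quantHolds_iff`). Parts 2 and
3 transform such strategies. For constants: if an atom `v = a` holds in every play, then `v` is
existential, since a universal variable can avoid `a`, and substituting `a` changes no play
(`Sentence.isTrue_iff_elimConst`). For instantiation: an element of `α ∩ β` is in both cubes, so
moving arguments of `τ_k` there cannot falsify it, and all existential variables may play `c`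
(`Sentence.isTrue_iff_instantiate`).

For co-NP, equalities between variables must be handled too, and a relation whose formula does not
define any `τ_k` must be refuted as well. Equalities split the terms into classes. A sentence over
the `τ_k` fails for one of three reasons: a class forces two different values; an existential
variable is forced to equal a universal one, and its class has no universal variable quantified
before it; or some universal assignment falsifies a relation after the unforced existential
variables are set to `c`.

A certificate prescribes values for some universal variables, possibly the symbolic value "open",
and an argument tuple at which the formulas are compared with `τ_k`. The verifier propagates values
along equalities, round by round. A round fills an unknown entry of the table or changes nothing, so
linearly many rounds reach a stable table.

Soundness (`verify_eq_false`): each propagated value is the actual value in the plays of a winning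
strategy, whatever element stands for "open"; hence nothing is ever refuted. Completeness
(`qcsp_of_verify_eq_false`): if no short certificate is accepted, the stable tables themselves
define a winning strategy, with `c` for unknown values. That a value depends on earlier variables
only is read off the table in which a single universal variable is open.

The rest implements the verifier on a multi-stack machine (`reach_clean_of_load`): a round is a
linear number of steps and the certificate has one tick per round, so the running time is quadratic.
-/

namespace PH

variable {A : Type}

/-! ### Strategies of the existential player -/

/-- `g` maps an assignment of the universal variables to an assignment of all variables. The values
of `u` at existential variables are ignored by the quantifier prefix, but `g` may look at them. -/
structure IsStrategy {n : ℕ} (q : Fin n → Quant) (g : (Fin n → A) → Fin n → A) : Prop where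
  all : ∀ u i, q i = .all → g u i = u i
  ex : ∀ u u' i, q i = .ex → (∀ j < i, u j = u' j) → g u i = g u' i

/-- Skolemization along the prefix: a leading universal variable lets the remaining strategy depend
on its value, a leading existential one contributes its fixed witness. -/
theorem QuantHolds.exists_strategy : ∀ {n : ℕ} {q : Fin n → Quant} {P : (Fin n → A) → Prop},
    QuantHolds n q P → ∃ g, IsStrategy q g ∧ ∀ u, P (g u)
  | 0, q, P, h => ⟨fun u => u, ⟨fun _ i => i.elim0, fun _ _ i => i.elim0⟩, fun u => by
      rw [Subsingleton.elim u Fin.elim0]; exact h⟩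
  | n + 1, q, P, h => by
    unfold QuantHolds at h
    cases hq : q 0 with
    | all =>
      simp only [hq] at h
      choose g hg hP using fun a => (h a).exists_strategy
      refine ⟨fun u => Fin.cons (u 0) (g (u 0) (Fin.tail u)), ⟨fun u i => ?_, fun u u' i => ?_⟩,
        fun u => hP _ _⟩
      · refine Fin.cases (fun _ => rfl) (fun i hi => ?_) i
        simpa [Fin.tail] using (hg (u 0)).all (Fin.tail u) i hi
      · refine Fin.cases (fun h0 => by simp [hq] at h0) (fun i hi huu => ?_) i
        have h0 : u 0 = u' 0 := huu 0 (Fin.succ_pos i)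
        simp only [Fin.cons_succ, h0]
        exact (hg (u' 0)).ex _ _ i hi fun j hj => huu j.succ (Fin.succ_lt_succ_iff.2 hj)
    | ex =>
      simp only [hq] at h
      obtain ⟨a, ha⟩ := h
      obtain ⟨g, hg, hP⟩ := ha.exists_strategy
      refine ⟨fun u => Fin.cons a (g (Fin.tail u)), ⟨fun u i => ?_, fun u u' i => ?_⟩,
        fun u => hP _⟩
      · refine Fin.cases (fun h0 => by simp [hq] at h0) (fun i hi => ?_) i
        simpa [Fin.tail] using hg.all (Fin.tail u) i hi
      · refine Fin.cases (fun _ _ => rfl) (fun i hi huu => ?_) i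
        simp only [Fin.cons_succ]
        exact hg.ex _ _ i hi fun j hj => huu j.succ (Fin.succ_lt_succ_iff.2 hj)

theorem IsStrategy.quantHolds [Nonempty A] : ∀ {n : ℕ} {q : Fin n → Quant}
    {P : (Fin n → A) → Prop} {g : (Fin n → A) → Fin n → A},
    IsStrategy q g → (∀ u, P (g u)) → QuantHolds n q P
  | 0, q, P, g, _, hP => by
    have := hP Fin.elim0
    rwa [Subsingleton.elim (g Fin.elim0) Fin.elim0] at this
  | n + 1, q, P, g, hg, hP => by
    unfold QuantHolds
    cases hq : q 0 with
    | all =>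
      intro a
      refine IsStrategy.quantHolds (g := fun u => Fin.tail (g (Fin.cons a u)))
        ⟨fun u i hi => ?_, fun u u' i hi huu => ?_⟩ fun u => ?_
      · simpa [Fin.tail] using hg.all (Fin.cons a u) i.succ hi
      · refine hg.ex _ _ i.succ hi fun j => Fin.cases (fun _ => rfl) (fun j hj => ?_) j
        simpa using huu j (Fin.succ_lt_succ_iff.1 hj)
      · have := hP (Fin.cons a u)
        rw [← Fin.cons_self_tail (g (Fin.cons a u)), hg.all _ 0 hq] at this
        exact this
    | ex =>
      obtain ⟨b⟩ := ‹Nonempty A›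
      -- No variable precedes the first one, so its existential value is the same in all plays and
      -- may be read off at any assignment.
      refine ⟨g (fun _ => b) 0, ?_⟩
      have : Nonempty A := ⟨b⟩
      refine IsStrategy.quantHolds (g := fun u => Fin.tail (g (Fin.cons b u)))
        ⟨fun u i hi => ?_, fun u u' i hi huu => ?_⟩ fun u => ?_
      · simpa [Fin.tail] using hg.all (Fin.cons b u) i.succ hi
      · refine hg.ex _ _ i.succ hi fun j => Fin.cases (fun _ => rfl) (fun j hj => ?_) j
        simpa using huu j (Fin.succ_lt_succ_iff.1 hj)
      · have := hP (Fin.cons b u)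
        rw [← Fin.cons_self_tail (g (Fin.cons b u)),
          hg.ex _ (fun _ => b) 0 hq fun j hj => absurd hj (Fin.not_lt_zero j)] at this
        exact this

theorem quantHolds_iff [Nonempty A] {n : ℕ} {q : Fin n → Quant} {P : (Fin n → A) → Prop} :
    QuantHolds n q P ↔ ∃ g, IsStrategy q g ∧ ∀ u, P (g u) :=
  ⟨QuantHolds.exists_strategy, fun ⟨_, hg, hP⟩ => hg.quantHolds hP⟩

theorem quantHolds_all [Nonempty A] {n : ℕ} {P : (Fin n → A) → Prop} :
    QuantHolds n (fun _ => .all) P ↔ ∀ x, P x := by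
  rw [quantHolds_iff]
  constructor
  · rintro ⟨g, hg, hP⟩ x
    have : g x = x := funext fun i => hg.all x i rfl
    exact this ▸ hP x
  · intro h
    exact ⟨id, ⟨fun _ _ _ => rfl, fun _ _ _ h => by cases h⟩, h⟩

/-! ### Substitution -/

theorem Term.eval_subst {n : ℕ} (s : Fin n → Term A n) (x : Fin n → A) (t : Term A n) :
    (t.subst s).eval x = t.eval fun i => (s i).eval x := by
  cases t <;> rfl

theorem Atom.holds_subst {n : ℕ} (s : Fin n → Term A n) (x : Fin n → A) (a : Atom A n) :
    (a.subst s).Holds x ↔ a.Holds fun i => (s i).eval x := by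
  cases a <;> simp [Atom.subst, Atom.Holds, Term.eval_subst]

theorem Sentence.Over.subst {B : Set (Σ r : ℕ, Set (Fin r → A))} {φ : Sentence A} (h : φ.Over B)
    (s : Fin φ.numVars → Term A φ.numVars) : (φ.subst s).Over B := by
  intro r f args hmem
  obtain ⟨a, ha, hs⟩ := List.mem_map.1 hmem
  cases a with
  | eq t u => cases hs
  | rel r' f' args' =>
    cases hs
    exact h _ _ _ ha

theorem Sentence.Over.elimConst [DecidableEq A] {B : Set (Σ r : ℕ, Set (Fin r → A))}
    {φ : Sentence A} (h : φ.Over B) : φ.elimConst.Over B := fun r f args hmem =>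
  h.subst φ.constSubst r f args (List.mem_of_mem_filter hmem)

/-! ### Elimination of constant atoms -/

theorem Atom.eval_of_constFor {n : ℕ} {v : Fin n} {a : Atom A n} {b : A}
    (h : a.constFor v = some b) {x : Fin n → A} (hx : a.Holds x) : x v = b := by
  unfold Atom.constFor at h
  split at h
  · split_ifs at h with hw
    cases h; subst hw; exact hx
  · split_ifs at h with hw
    cases h; subst hw; exact hx.symm
  · cases h

/-- The substituted constant comes from an atom of the matrix, and that atom holds at `x`. -/
theorem Sentence.eval_constSubst {φ : Sentence A} {x : Fin φ.numVars → A}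
    (hx : ∀ a ∈ φ.matrix, a.Holds x) (v : Fin φ.numVars) : (φ.constSubst v).eval x = x v := by
  unfold Sentence.constSubst
  split
  · rename_i b _ hb
    obtain ⟨a, ha, hab⟩ := List.exists_of_findSome?_eq_some hb
    exact (Atom.eval_of_constFor hab (hx a ha)).symm
  · rfl

theorem Sentence.constSubst_eq_var {φ : Sentence A} {v w : Fin φ.numVars}
    (h : φ.constSubst v = .var w) :
    v = w ∧ (φ.quant v = .all ∨ ∀ a ∈ φ.matrix, a.constFor v = none) := by
  unfold Sentence.constSubst at h
  split at h
  · cases h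
  · rename_i hne
    refine ⟨by cases h; rfl, ?_⟩
    cases hq : φ.quant v with
    | all => exact .inl rfl
    | ex =>
      right
      cases hf : φ.matrix.findSome? (Atom.constFor v) with
      | none => exact fun a ha => List.findSome?_eq_none_iff.1 hf a ha
      | some b => exact (hne b hq hf).elim

theorem Sentence.constSubst_of_all {φ : Sentence A} {v : Fin φ.numVars}
    (h : φ.quant v = .all) : φ.constSubst v = .var v := by
  unfold Sentence.constSubst
  split
  · simp_all
  · rfl

theorem Atom.nontrivial_eq_false [DecidableEq A] {n : ℕ} {a : Atom A n}
    (h : a.nontrivial = false) (x : Fin n → A) : a.Holds x := by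
  unfold Atom.nontrivial at h
  split at h
  · simp only [ne_eq, decide_not, Bool.not_eq_eq_eq_not, Bool.not_false, decide_eq_true_eq] at h
    exact h
  · cases h

/-- In a true sentence, no equality between a universal variable and a constant holds. -/
theorem Sentence.IsTrue.no_isEq_elimConst [Nontrivial A] [DecidableEq A] {φ : Sentence A}
    (hφ : ∀ a ∈ φ.matrix, ¬ a.IsVarEq) (h : φ.IsTrue) : ∀ a ∈ φ.elimConst.matrix, ¬ a.IsEq := by
  obtain ⟨g, hg, hP⟩ := QuantHolds.exists_strategy h
  intro a ha haeq
  obtain ⟨ha, hnt⟩ := List.mem_filter.1 ha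
  obtain ⟨a, hamem, rfl⟩ := List.mem_map.1 ha
  -- A variable with an atom `v = b` can stay in place only if it is universal, and then it can be
  -- played different from `b`.
  have hvar : ∀ v b, (∀ u, g u v = b) → a.constFor v = some b → φ.constSubst v ≠ .var v := by
    intro v b hb hc hs
    rcases (Sentence.constSubst_eq_var hs).2 with hq | hno
    · obtain ⟨b', hb'⟩ := exists_ne b
      exact hb' ((hg.all (fun _ => b') v hq).symm.trans (hb _))
    · simp [hno a hamem] at hc
  -- The constant put for `v` may stem from another, earlier atom. Both atoms hold in the same play,
  -- so it is still `b`, and the atom at hand becomes `b = b`, which is deleted.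
  have hvar' : ∀ v b, (∀ u, g u v = b) → a.constFor v = some b → φ.constSubst v = .const b := by
    intro v b hb hc
    cases hs : φ.constSubst v with
    | var w => exact absurd (by rw [hs, (Sentence.constSubst_eq_var hs).1]) (hvar v b hb hc)
    | const b' =>
      obtain ⟨b0⟩ := (inferInstance : Nonempty A)
      have := Sentence.eval_constSubst (hP fun _ => b0) v
      rw [hs, hb] at this
      exact congrArg _ this
  cases a with
  | rel r f args => exact haeq
  | eq t u =>
    have hol : ∀ y, t.eval (g y) = u.eval (g y) := fun y => hP y _ hamem
    cases t with
    | var v =>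
      cases u with
      | var w => exact hφ _ hamem trivial
      | const b =>
        simp [Atom.subst, Term.subst, hvar' v b hol (by simp [Atom.constFor]),
          Atom.nontrivial] at hnt
    | const b =>
      cases u with
      | var w =>
        simp [Atom.subst, Term.subst, hvar' w b (fun y => (hol y).symm) (by simp [Atom.constFor]),
          Atom.nontrivial] at hnt
      | const b' =>
        obtain ⟨b0⟩ := (inferInstance : Nonempty A)
        simp only [Atom.subst, Term.subst, Atom.nontrivial, ne_eq, decide_eq_true_eq] at hnt
        exact hnt (hol fun _ => b0)

/-- The deleted atoms hold under every assignment, so only the substitution matters for truth. -/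
theorem Sentence.isTrue_elimConst [DecidableEq A] {φ : Sentence A} :
    φ.elimConst.IsTrue ↔ QuantHolds φ.numVars φ.quant
      fun x => ∀ a ∈ φ.matrix, a.Holds fun v => (φ.constSubst v).eval x := by
  have : ∀ x : Fin φ.numVars → A,
      (∀ a ∈ (φ.matrix.map (Atom.subst φ.constSubst)).filter Atom.nontrivial, a.Holds x) ↔
        ∀ a ∈ φ.matrix, a.Holds fun v => (φ.constSubst v).eval x := by
    intro x
    simp only [List.mem_filter, List.mem_map, ← Atom.holds_subst]
    constructor
    · intro h a ha
      cases hnt : (a.subst φ.constSubst).nontrivial with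
      | false => exact Atom.nontrivial_eq_false hnt _
      | true => exact h _ ⟨⟨a, ha, rfl⟩, hnt⟩
    · rintro h _ ⟨⟨a, ha, rfl⟩, -⟩
      exact h a ha
  rw [← funext fun x => propext (this x)]
  rfl

/-- The same strategy wins both ways. From left to right the substitution does not alter the plays;
from right to left it is composed with the strategy, which stays legal because a substituted value
is a constant. -/
theorem Sentence.isTrue_iff_elimConst [Nontrivial A] [DecidableEq A] {φ : Sentence A}
    (hφ : ∀ a ∈ φ.matrix, ¬ a.IsVarEq) :
    φ.IsTrue ↔ (∀ a ∈ φ.elimConst.matrix, ¬ a.IsEq) ∧ φ.elimConst.IsTrue := by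
  refine ⟨fun h => ⟨h.no_isEq_elimConst hφ, ?_⟩, fun ⟨_, h⟩ => ?_⟩
  · obtain ⟨g, hg, hP⟩ := QuantHolds.exists_strategy h
    refine Sentence.isTrue_elimConst.2 (IsStrategy.quantHolds hg fun u a ha => ?_)
    rw [funext (Sentence.eval_constSubst (hP u))]
    exact hP u a ha
  · obtain ⟨g, hg, hP⟩ := QuantHolds.exists_strategy (Sentence.isTrue_elimConst.1 h)
    refine IsStrategy.quantHolds (g := fun u v => (φ.constSubst v).eval (g u))
      ⟨fun u i hi => ?_, fun u u' i hi huu => ?_⟩ fun u a ha => hP u a ha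
    · rw [Sentence.constSubst_of_all hi]
      exact hg.all u i hi
    · cases hs : φ.constSubst i with
      | const b => rfl
      | var w =>
        obtain rfl := (Sentence.constSubst_eq_var hs).1
        exact hg.ex u u' i hi huu

/-! ### Instantiation -/

/-- An element of `α ∩ β` fits into either cube, so the triple that witnesses the disjunction keeps
doing so. -/
theorem tau_of_le {α β : Set A} {k : ℕ} {x y : Fin (3 * k) → A}
    (h : ∀ i, y i = x i ∨ y i ∈ α ∩ β) (hx : x ∈ tau α β k) : y ∈ tau α β k := by
  obtain ⟨i, hi⟩ := hx
  have ha : ∀ j, x j ∈ α → y j ∈ α := fun j hj => (h j).elim (fun e => e ▸ hj) fun m => m.1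
  have hb : ∀ j, x j ∈ β → y j ∈ β := fun j hj => (h j).elim (fun e => e ▸ hj) fun m => m.2
  exact ⟨i, hi.imp (fun ⟨p, q, r⟩ => ⟨ha _ p, ha _ q, ha _ r⟩)
    fun ⟨p, q, r⟩ => ⟨hb _ p, hb _ q, hb _ r⟩⟩

theorem exists_eq_tau_of_mem {α β : Set A} {r : ℕ} {R : Set (Fin r → A)}
    (h : (⟨r, R⟩ : Σ r : ℕ, Set (Fin r → A)) ∈ tauLanguage α β) :
    ∃ k, ∃ hk : r = 3 * k, R = hk ▸ tau α β k := by
  obtain ⟨k, hk⟩ := h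
  cases hk
  exact ⟨k, rfl, rfl⟩

theorem mem_of_le_of_mem_tauLanguage {α β : Set A} {r : ℕ} {R : Set (Fin r → A)}
    (hR : (⟨r, R⟩ : Σ r : ℕ, Set (Fin r → A)) ∈ tauLanguage α β) {x y : Fin r → A}
    (h : ∀ i, y i = x i ∨ y i ∈ α ∩ β) (hx : x ∈ R) : y ∈ R := by
  obtain ⟨k, rfl, rfl⟩ := exists_eq_tau_of_mem hR
  exact tau_of_le h hx

/-- Changing the existential values of a winning strategy to `c` preserves every atom by the
monotonicity above. Conversely, always playing `c` is a strategy. -/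
theorem Sentence.isTrue_iff_instantiate {α β : Set A} {φ : Sentence A}
    (hover : φ.Over (tauLanguage α β)) (hφ : ∀ a ∈ φ.matrix, ¬ a.IsEq) {c : A} (hc : c ∈ α ∩ β) :
    φ.IsTrue ↔ (φ.instantiate c).IsTrue := by
  have : Nonempty A := ⟨c⟩
  have hmat : (φ.instantiate c).IsTrue ↔ ∀ u : Fin φ.numVars → A, ∀ a ∈ φ.matrix,
      a.Holds fun v => match φ.quant v with | .all => u v | .ex => c := by
    refine quantHolds_all.trans (forall_congr' fun u => ?_)
    refine List.forall_mem_map.trans (forall₂_congr fun a _ => (Atom.holds_subst _ _ _).trans ?_)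
    have : (fun i => Term.eval u (match φ.quant i with | .all => .var i | .ex => .const c)) =
        fun v => match φ.quant v with | .all => u v | .ex => c := by
      funext i
      cases φ.quant i <;> rfl
    rw [← this]
    rfl
  rw [hmat]
  constructor
  · intro h u a ha
    obtain ⟨g, hg, hP⟩ := QuantHolds.exists_strategy h
    cases a with
    | eq => exact (hφ _ ha trivial).elim
    | rel r f args =>
      refine mem_of_le_of_mem_tauLanguage (hover _ _ _ ha) (fun i => ?_) (hP u _ ha)
      cases args i with
      | const b => exact .inl rfl
      | var v =>
        simp only [Term.eval]
        cases hq : φ.quant v with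
        | all => exact .inl (hg.all u v hq).symm
        | ex => exact .inr hc
  · intro h
    refine IsStrategy.quantHolds (g := fun u v => match φ.quant v with | .all => u v | .ex => c)
      ⟨fun u i hi => by simp [hi], fun u u' i hi _ => by simp [hi]⟩ h

/-! ### The verifier: tables of values -/

/-- What a table knows about a variable: nothing (`none`), that it is equal to a universal variable
whose value is left open (`some none`), or that it has the value `a` (`some (some a)`). -/
abbrev Val (A : Type) : Type := Option (Option A)

/-- An open value clashes with every definite one: a universal variable can avoid any single
element. Two open values do not clash. -/
def clash [DecidableEq A] : Val A → Val A → Bool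
  | some v, some w => decide (v ≠ w)
  | _, _ => false

def Term.lookup {n : ℕ} (T : List (Val A)) : Term A n → Val A
  | .var i => T.getD i none
  | .const a => some (some a)

/-- If the table knows nothing about the term, store `w`. -/
def Term.update {n : ℕ} (T : List (Val A)) (w : Val A) : Term A n → List (Val A)
  | .var i => T.modify i (·.or w)
  | .const _ => T

/-- Merge the value of a term with the current value, and record clashes. -/
def merge [DecidableEq A] {n : ℕ} (s : List (Val A) × Val A × Bool) (t : Term A n) :
    List (Val A) × Val A × Bool :=
  (t.update s.1 s.2.1, (t.lookup s.1).or s.2.1, s.2.2 || clash (t.lookup s.1) s.2.1)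

/-- `T'` has at least the information of `T`. -/
def Extends (T T' : List (Val A)) : Prop := List.Forall₂ (fun e e' => e = none ∨ e = e') T T'

theorem Extends.refl (T : List (Val A)) : Extends T T :=
  List.forall₂_same.2 fun _ _ => .inr rfl

theorem Extends.trans {T₁ T₂ T₃ : List (Val A)} (h : Extends T₁ T₂) (h' : Extends T₂ T₃) :
    Extends T₁ T₃ := by
  induction h generalizing T₃ with
  | nil => exact h'
  | cons hd _ ih =>
    cases h' with
    | cons hd' tl' =>
      refine .cons ?_ (ih tl')
      rcases hd with rfl | rfl
      · exact .inl rfl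
      · exact hd'

theorem Extends.length_eq {T T' : List (Val A)} (h : Extends T T') : T.length = T'.length :=
  List.Forall₂.length_eq h

theorem Extends.getD {T T' : List (Val A)} (h : Extends T T') {i : ℕ} {w : Option A}
    (hw : T.getD i none = some w) : T'.getD i none = some w := by
  induction h generalizing i with
  | nil => exact hw
  | cons hd _ ih =>
    cases i with
    | zero => rcases hd with rfl | rfl <;> simp_all
    | succ i => simpa using ih (by simpa using hw)

theorem Extends.modify (T : List (Val A)) (i : ℕ) (w : Val A) :
    Extends T (T.modify i (·.or w)) := by
  induction T generalizing i with
  | nil => simpa using Extends.refl _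
  | cons e T ih =>
    cases i with
    | zero =>
      refine .cons ?_ (Extends.refl _)
      cases e
      · exact .inl rfl
      · exact .inr rfl
    | succ i => exact .cons (.inr rfl) (ih i)

theorem Extends.update (T : List (Val A)) (w : Val A) {n : ℕ} (t : Term A n) :
    Extends T (t.update T w) := by
  cases t with
  | const a => exact Extends.refl _
  | var i => exact Extends.modify T i w

/-- Known entries are never erased or altered, so the number of unknown entries is a potential that
bounds the number of productive rounds. -/
theorem Extends.count_le [DecidableEq A] {T T' : List (Val A)} (h : Extends T T') :
    T'.count none ≤ T.count none := by
  induction h with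
  | nil => rfl
  | @cons e e' _ _ hd _ ih =>
    simp only [List.count_cons]
    rcases hd with rfl | rfl
    · have : (if e' == none then 1 else 0) ≤ 1 := by split <;> simp
      simp only [BEq.rfl, if_true]
      omega
    · omega

theorem Extends.eq_of_count [DecidableEq A] {T T' : List (Val A)} (h : Extends T T')
    (hc : T'.count none = T.count none) : T = T' := by
  induction h with
  | nil => rfl
  | @cons e e' _ _ hd tl ih =>
    have hle := Extends.count_le tl
    simp only [List.count_cons] at hc
    rcases hd with rfl | rfl
    · cases e' with
      | none => rw [ih (by simpa using hc)]
      | some w => simp at hc; omega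
    · rw [ih (by omega)]

theorem Extends.antisymm [DecidableEq A] {T T' : List (Val A)} (h : Extends T T')
    (h' : Extends T' T) : T = T' :=
  h.eq_of_count (le_antisymm h.count_le h'.count_le)

theorem Term.lookup_update_self {n : ℕ} {T : List (Val A)} (hT : T.length = n) (w : Val A)
    (t : Term A n) (ht : ∀ a, t ≠ .const a) : t.lookup (t.update T w) = (t.lookup T).or w := by
  cases t with
  | const a => exact (ht a rfl).elim
  | var i =>
    have hi : (i : ℕ) < T.length := hT ▸ i.isLt
    simp [Term.lookup, Term.update, List.getD_eq_getElem?_getD, hi]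

theorem Term.lookup_update {n : ℕ} {T : List (Val A)} {w : Val A} {t : Term A n} {i : Fin n}
    {v : Option A} (h : (Term.var i : Term A n).lookup (t.update T w) = some v) :
    (Term.var i : Term A n).lookup T = some v ∨ t = .var i ∧ w = some v := by
  cases t with
  | const a => exact .inl h
  | var j =>
    simp only [Term.lookup, Term.update, List.getD_eq_getElem?_getD, List.getElem?_modify] at h ⊢
    by_cases hij : (j : ℕ) = i
    · have := Fin.ext hij; subst this
      cases hT : T[(j : ℕ)]? with
      | none => simp [hT] at h
      | some e =>
        cases e with
        | none => simp [hT] at h; exact .inr ⟨rfl, h⟩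
        | some e => simp [hT] at h; simp [h]
    · simp [hij] at h; simp [h]

/-- The clash flag is accumulated but never consulted, so it factors out of the fold. -/
theorem merge_snd [DecidableEq A] {n : ℕ} (l : List (Term A n)) (T : List (Val A)) (w : Val A)
    (b : Bool) : l.foldl merge (T, w, b) = ((l.foldl merge (T, w, false)).1,
      (l.foldl merge (T, w, false)).2.1, b || (l.foldl merge (T, w, false)).2.2) := by
  induction l generalizing T w b with
  | nil => simp
  | cons t l ih =>
    simp only [List.foldl_cons, merge]
    rw [ih, ih _ _ (false || _)]
    simp [Bool.or_assoc]

theorem Extends.foldl_merge [DecidableEq A] {n : ℕ} (l : List (Term A n))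
    (s : List (Val A) × Val A × Bool) : Extends s.1 (l.foldl merge s).1 := by
  induction l generalizing s with
  | nil => exact Extends.refl _
  | cons t l ih => exact (Extends.update _ _ t).trans (ih (merge s t))

/-! ### The verifier: refuting the relations -/

/-- Scans the arguments of a relation in triples. `fail` means that each triple so far has
a known value outside of `α` and one outside of `β`. -/
structure Tracker : Type where
  phase : Fin 3
  outα : Bool
  outβ : Bool
  fail : Bool

/-- `fail` starts as `true` because the empty disjunction `τ_0` is false. -/
def Tracker.init : Tracker := ⟨0, false, false, true⟩

/-- A triple is outside both cubes exactly if some entry is outside `α` and some entry is outside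
`β`, so two flags per triple suffice. An unknown entry sets neither. -/
def Tracker.next (inα inβ : A → Bool) (k : Tracker) (v : Option A) : Tracker :=
  let p := k.outα || v.any fun a => !inα a
  let q := k.outβ || v.any fun a => !inβ a
  if k.phase = 2 then ⟨0, false, false, k.fail && p && q⟩ else ⟨k.phase + 1, p, q, k.fail⟩

def tracks (inα inβ : A → Bool) (l : List (Option A)) : Tracker :=
  l.foldl (Tracker.next inα inβ) Tracker.init

theorem Tracker.phase_next (inα inβ : A → Bool) (k : Tracker) (v : Option A) :
    ((k.next inα inβ v).phase : ℕ) = (k.phase + 1) % 3 := by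
  unfold Tracker.next
  split
  · rename_i h
    simp [h]
  · exact Fin.val_add _ _

/-- The final phase exposes an arity that is not a multiple of three. -/
theorem phase_tracks (inα inβ : A → Bool) (l : List (Option A)) :
    ((tracks inα inβ l).phase : ℕ) = l.length % 3 := by
  have : ∀ k : Tracker,
      ((l.foldl (Tracker.next inα inβ) k).phase : ℕ) = (k.phase + l.length) % 3 := by
    induction l with
    | nil => intro k; simp only [List.foldl_nil, List.length_nil]; omega
    | cons v l ih =>
      intro k
      rw [List.foldl_cons, ih, Tracker.phase_next, List.length_cons]
      omega
  simpa [tracks, Tracker.init] using this Tracker.init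

/-- Induction on the number of triples: three symbols bring the tracker back to phase 0 with cleared
flags, and only `fail` carries over. Values indexed by `ℕ` avoid dependent indices in the induction.
-/
theorem tracks_range (inα inβ : A → Bool) (y : ℕ → Option A) (k : ℕ) :
    ∃ b : Bool, tracks inα inβ ((List.range (3 * k)).map y) = ⟨0, false, false, b⟩ ∧
      (b = true ↔ ∀ i < k, (∃ p < 3, ∃ a, y (3 * i + p) = some a ∧ inα a = false) ∧
        (∃ p < 3, ∃ a, y (3 * i + p) = some a ∧ inβ a = false)) := by
  induction k with
  | zero => exact ⟨true, rfl, by simp⟩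
  | succ k ih =>
    obtain ⟨b, hb, hiff⟩ := ih
    have h3 : 3 * (k + 1) = 3 * k + 1 + 1 + 1 := by ring
    have hany : ∀ f : A → Bool, (((y (3 * k)).any fun a => !f a) ||
        ((y (3 * k + 1)).any fun a => !f a) || ((y (3 * k + 1 + 1)).any fun a => !f a)) = true ↔
        ∃ p < 3, ∃ a, y (3 * k + p) = some a ∧ f a = false := by
      intro f
      simp only [Bool.or_eq_true, Option.any_eq_true, Bool.not_eq_true']
      constructor
      · rintro ((h | h) | h)
        · exact ⟨0, by norm_num, h⟩
        · exact ⟨1, by norm_num, h⟩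
        · exact ⟨2, by norm_num, h⟩
      · rintro ⟨p, hp, h⟩
        interval_cases p
        · exact .inl (.inl h)
        · exact .inl (.inr h)
        · exact .inr h
    refine ⟨b && (((y (3 * k)).any fun a => !inα a) ||
        ((y (3 * k + 1)).any fun a => !inα a) || ((y (3 * k + 1 + 1)).any fun a => !inα a)) &&
        (((y (3 * k)).any fun a => !inβ a) ||
        ((y (3 * k + 1)).any fun a => !inβ a) || ((y (3 * k + 1 + 1)).any fun a => !inβ a)),
        ?_, ?_⟩
    · rw [h3, List.range_succ, List.range_succ, List.range_succ]
      simp only [tracks, List.map_append, List.foldl_append, List.map_cons, List.map_nil,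
        List.foldl_cons, List.foldl_nil] at hb ⊢
      rw [hb]
      simp [Tracker.next]
    · rw [Bool.and_eq_true, Bool.and_eq_true, hiff, hany, hany]
      constructor
      · rintro ⟨⟨h1, h2⟩, h3⟩ i hi
        rcases Nat.lt_succ_iff_lt_or_eq.1 hi with hi | rfl
        · exact h1 i hi
        · exact ⟨h2, h3⟩
      · intro h
        exact ⟨⟨fun i hi => h i (by omega), (h k (by omega)).1⟩, (h k (by omega)).2⟩

def QF.val [DecidableEq A] {r : ℕ} (x : Fin r → A) : QF A r → Bool
  | .eq s t => decide (s.eval x = t.eval x)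
  | .neg f => !f.val x
  | .and f g => f.val x && g.val x
  | .or f g => f.val x || g.val x

theorem QF.val_eq_true [DecidableEq A] {r : ℕ} (x : Fin r → A) (f : QF A r) :
    f.val x = true ↔ x ∈ f.relation := by
  change f.val x = true ↔ f.Holds x
  induction f with
  | eq s t => simp [QF.val, QF.Holds]
  | neg f ih => simp [QF.val, QF.Holds, ← ih]
  | and f g ihf ihg => simp [QF.val, QF.Holds, ← ihf, ← ihg]
  | or f g ihf ihg => simp [QF.val, QF.Holds, ← ihf, ← ihg]

/-! ### The verifier: rounds -/

section Rounds
variable [DecidableEq A] (inα inβ : A → Bool) (c : A) (X : List A)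

/-- The table after processing an atom. -/
def Atom.table {n : ℕ} (T : List (Val A)) : Atom A n → List (Val A)
  | .eq s t => ([s, t, s, t].foldl merge (T, none, false)).1
  | .rel _ _ _ => T

/-- Does processing the atom refute the sentence? -/
def Atom.refutes {n : ℕ} (T : List (Val A)) : Atom A n → Bool
  | .eq s t => ([s, t, s, t].foldl merge (T, none, false)).2.2
  | .rel r f args =>
    let k := tracks inα inβ ((List.ofFn args).map fun t => (t.lookup T).join)
    let k' := tracks inα inβ ((List.range r).map fun j => some (X.getD j c))
    -- `k'.fail` is the negation of `τ` at the tuple `X`, so equality with the value of `f` means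
    -- that `f` and `τ` disagree there.
    decide (k.phase ≠ 0) || k.fail || (f.val (fun j => X.getD j c) == k'.fail)

/-- Is the first open value at an existential variable? -/
def openEx : List Quant → List (Val A) → Bool
  | q :: qs, e :: T =>
    match e, q with
    | some none, .all => false
    | some none, .ex => true
    | _, _ => openEx qs T
  | _, _ => false

/-- Forget the values of existential variables. -/
def reset : List Quant → List (Val A) → List (Val A)
  | .all :: qs, e :: T => e :: reset qs T
  | .ex :: qs, _ :: T => none :: reset qs T
  | _, T => T

def atomStep {n : ℕ} (s : List (Val A) × Bool) (a : Atom A n) : List (Val A) × Bool :=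
  (a.table s.1, s.2 || a.refutes inα inβ c X s.1)

def round (φ : Sentence A) (s : List (Val A) × Bool) : List (Val A) × Bool :=
  φ.matrix.foldl (atomStep inα inβ c X) (s.1, s.2 || openEx (List.ofFn φ.quant) s.1)

end Rounds

/-- The symbols of certificates. -/
inductive Cert (A : Type) : Type
  | entry (e : Val A)
  | asg (a : A)
  | tick

def Cert.entry? : Cert A → Option (Val A)
  | .entry e => some e
  | _ => none

def Cert.asg? : Cert A → Option A
  | .asg a => some a
  | _ => none

def Cert.tick? : Cert A → Option Unit
  | .tick => some ()
  | _ => none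

/-- Accept if a round started from the table in the certificate refutes the sentence. -/
def verify [DecidableEq A] (inα inβ : A → Bool) (c : A) (w : Sentence A × List (Cert A)) : Bool :=
  ((round inα inβ c (w.2.filterMap Cert.asg?).reverse w.1)^[(w.2.filterMap Cert.tick?).length]
    (reset (List.ofFn w.1.quant) (w.2.filterMap Cert.entry?).reverse, false)).2

/-! ### What a table can know -/

/-- The equalities of the sentence connect the terms. -/
def Connected (φ : Sentence A) : Term A φ.numVars → Term A φ.numVars → Prop :=
  Relation.EqvGen fun s t => Atom.eq s t ∈ φ.matrix

/-- The value `w` is given to a constant or, by the table `T₀`, to a universal variable. -/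
def Root (φ : Sentence A) (T₀ : List (Val A)) (w : Option A) : Term A φ.numVars → Prop
  | .var i => φ.quant i = .all ∧ T₀.getD i none = some w
  | .const a => w = some a

def Derives (φ : Sentence A) (T₀ : List (Val A)) (t : Term A φ.numVars) (w : Option A) : Prop :=
  ∃ s, Connected φ s t ∧ Root φ T₀ w s

theorem Derives.of_connected {φ : Sentence A} {T₀ : List (Val A)} {s t : Term A φ.numVars}
    {w : Option A} (h : Derives φ T₀ s w) (hst : Connected φ s t) : Derives φ T₀ t w :=
  let ⟨r, hr, hw⟩ := h
  ⟨r, hr.trans _ _ _ hst, hw⟩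

/-- All values in `T` are derived. -/
def Sound (φ : Sentence A) (T₀ T : List (Val A)) : Prop :=
  ∀ (i : Fin φ.numVars) (w : Option A), (Term.var i : Term A φ.numVars).lookup T = some w →
    Derives φ T₀ (.var i) w

theorem Sound.lookup {φ : Sentence A} {T₀ T : List (Val A)} (h : Sound φ T₀ T)
    {t : Term A φ.numVars} {w : Option A} (hw : t.lookup T = some w) : Derives φ T₀ t w := by
  cases t with
  | var i => exact h i w hw
  | const a =>
    simp only [Term.lookup, Option.some.injEq] at hw
    exact ⟨.const a, .refl _, hw.symm⟩

theorem connected_of_mem {φ : Sentence A} {s t : Term A φ.numVars} (h : Atom.eq s t ∈ φ.matrix) :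
    ∀ u ∈ [s, t, s, t], Connected φ s u := by
  have : Connected φ s t := .rel _ _ h
  have h' : Connected φ s s := .refl _
  simp [this, h']

/-! ### Open entries and the reset of a table -/

theorem openEx_eq_true_iff (qs : List Quant) (T : List (Val A)) :
    openEx qs T = true ↔ ∃ v, qs[v]? = some .ex ∧ T.getD v none = some none ∧
      ∀ i < v, T.getD i none ≠ some none := by
  induction qs generalizing T with
  | nil => simp [openEx]
  | cons q qs ih =>
    cases T with
    | nil => simp [openEx]
    | cons e T =>
      by_cases he : e = some none
      · subst he
        have h0 : ∀ v, (∀ i < v, (some none :: T).getD i none ≠ some none) → v = 0 := fun v hv =>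
          Nat.eq_zero_of_not_pos fun h => hv 0 h rfl
        cases q with
        | all =>
          simp only [openEx, Bool.false_eq_true, false_iff]
          rintro ⟨v, hv, -, h⟩
          obtain rfl := h0 v h
          simp at hv
        | ex => exact iff_of_true rfl ⟨0, rfl, rfl, by simp⟩
      · have : openEx (q :: qs) (e :: T) = openEx qs T := by
          cases q <;> rcases e with _ | _ | a <;> first | rfl | exact absurd rfl he
        rw [this, ih]
        constructor
        · rintro ⟨v, h1, h2, h3⟩
          refine ⟨v + 1, by simpa using h1, by simpa using h2, fun i hi => ?_⟩
          cases i with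
          | zero => simpa using he
          | succ i => simpa using h3 i (by omega)
        · rintro ⟨v, h1, h2, h3⟩
          cases v with
          | zero => exact (he (by simpa using h2)).elim
          | succ v =>
            exact ⟨v, by simpa using h1, by simpa using h2, fun i hi => by
              simpa using h3 (i + 1) (by omega)⟩

theorem getD_reset {qs : List Quant} {T : List (Val A)} {i : ℕ} {w : Option A}
    (h : (reset qs T).getD i none = some w) : qs[i]? ≠ some .ex := by
  induction qs generalizing T i with
  | nil => simp
  | cons q qs ih =>
    cases T with
    | nil => cases q <;> simp [reset] at h
    | cons e T =>
      cases i with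
      | zero => cases q <;> simp_all [reset]
      | succ i =>
        have : (reset qs T).getD i none = some w := by cases q <;> simpa [reset] using h
        simpa using ih this

theorem reset_eq_self {qs : List Quant} {T : List (Val A)}
    (h : ∀ i : ℕ, qs[i]? = some .ex → T.getD i none = none) : reset qs T = T := by
  induction qs generalizing T with
  | nil => simp [reset]
  | cons q qs ih =>
    cases T with
    | nil => cases q <;> rfl
    | cons e T =>
      have := ih (T := T) fun i hi => by simpa using h (i + 1) (by simpa using hi)
      cases q with
      | all => simp [reset, this]
      | ex =>
        have h0 := h 0 rfl
        simp only [List.getD_cons_zero] at h0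
        simp [reset, this, h0]

section Rounds
variable [DecidableEq A]

/-- All terms of the list are in the class of `t₀`, so the current value is always one derived for
`t₀`. A clash would exhibit two different derived values of `t₀`. -/
theorem Sound.foldl_merge {φ : Sentence A} {T₀ : List (Val A)} {t₀ : Term A φ.numVars}
    (l : List (Term A φ.numVars)) (hl : ∀ t ∈ l, Connected φ t₀ t)
    (s : List (Val A) × Val A × Bool) (hs : Sound φ T₀ s.1)
    (hw : ∀ v, s.2.1 = some v → Derives φ T₀ t₀ v) :
    Sound φ T₀ (l.foldl merge s).1 ∧
      ((∀ t w w', Derives φ T₀ t w → Derives φ T₀ t w' → w = w') → s.2.2 = false →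
        (l.foldl merge s).2.2 = false) := by
  induction l generalizing s with
  | nil => exact ⟨hs, fun _ h => h⟩
  | cons t l ih =>
    have ht := hl t (by simp)
    have ht' : ∀ v, t.lookup s.1 = some v → Derives φ T₀ t₀ v := fun v hv =>
      (hs.lookup hv).of_connected (ht.symm _ _)
    obtain ⟨h1, h2⟩ := ih (fun u hu => hl u (by simp [hu])) (merge s t) (fun i w hi => by
      rcases Term.lookup_update hi with h | ⟨rfl, h⟩
      · exact hs i w h
      · exact (hw _ h).of_connected ht) (fun v hv => by
      simp only [merge, Option.or_eq_some_iff] at hv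
      exact hv.elim (ht' v) fun h => hw v h.2)
    refine ⟨h1, fun huniq hb => h2 huniq ?_⟩
    simp only [merge, hb, Bool.false_or]
    unfold clash
    split
    · rename_i v w hv hw'
      simpa using huniq _ _ _ (ht' v hv) (hw w hw')
    · rfl

theorem Sound.table {φ : Sentence A} {T₀ T : List (Val A)} (h : Sound φ T₀ T)
    {a : Atom A φ.numVars} (ha : a ∈ φ.matrix) : Sound φ T₀ (a.table T) := by
  cases a with
  | rel => exact h
  | eq s t => exact (Sound.foldl_merge _ (connected_of_mem ha) (T, none, false) h (by simp)).1

theorem Extends.table {n : ℕ} (T : List (Val A)) (a : Atom A n) : Extends T (a.table T) := by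
  cases a with
  | rel => exact .refl _
  | eq s t => exact Extends.foldl_merge _ (T, none, false)

variable {inα inβ : A → Bool} {c : A} {X : List A}

theorem Extends.foldl_atomStep {n : ℕ} (l : List (Atom A n)) (s : List (Val A) × Bool) :
    Extends s.1 (l.foldl (atomStep inα inβ c X) s).1 := by
  induction l generalizing s with
  | nil => exact .refl _
  | cons a l ih => exact (Extends.table _ a).trans (ih (atomStep inα inβ c X s a))

theorem Sound.foldl_atomStep {φ : Sentence A} {T₀ : List (Val A)} (l : List (Atom A φ.numVars))
    (hl : ∀ a ∈ l, a ∈ φ.matrix) (s : List (Val A) × Bool) (hs : Sound φ T₀ s.1) :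
    Sound φ T₀ (l.foldl (atomStep inα inβ c X) s).1 := by
  induction l generalizing s with
  | nil => exact hs
  | cons a l ih =>
    exact ih (fun b hb => hl b (by simp [hb])) (atomStep inα inβ c X s a) (hs.table (hl a (by simp)))

theorem foldl_atomStep_eq_false {φ : Sentence A} {T₀ : List (Val A)}
    (l : List (Atom A φ.numVars)) (hl : ∀ a ∈ l, a ∈ φ.matrix) (s : List (Val A) × Bool)
    (hs : Sound φ T₀ s.1) (hb : s.2 = false)
    (h : ∀ a ∈ l, ∀ T, Sound φ T₀ T → a.refutes inα inβ c X T = false) :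
    (l.foldl (atomStep inα inβ c X) s).2 = false := by
  induction l generalizing s with
  | nil => exact hb
  | cons a l ih =>
    refine ih (fun b hb => hl b (by simp [hb])) _ (hs.table (hl a (by simp))) ?_
      fun b hb => h b (by simp [hb])
    simp [atomStep, hb, h a (by simp) _ hs]

/-- Each atom meets its own intermediate table `T`. What matters is that `T` lies between the tables
at the beginning and at the end: if these coincide, `T` is equal to both. -/
theorem of_foldl_atomStep_eq_false {n : ℕ} (l : List (Atom A n)) (s : List (Val A) × Bool)
    (h : (l.foldl (atomStep inα inβ c X) s).2 = false) :
    s.2 = false ∧ ∀ a ∈ l, ∃ T, Extends s.1 T ∧ a.refutes inα inβ c X T = false ∧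
        Extends (a.table T) (l.foldl (atomStep inα inβ c X) s).1 := by
  induction l generalizing s with
  | nil => exact ⟨h, by simp⟩
  | cons a l ih =>
    obtain ⟨h1, h3⟩ := ih _ h
    simp only [atomStep, Bool.or_eq_false_iff] at h1
    refine ⟨h1.1, fun b hb => ?_⟩
    rcases List.mem_cons.1 hb with rfl | hb
    · exact ⟨s.1, .refl _, h1.2, Extends.foldl_atomStep l (atomStep inα inβ c X s b)⟩
    · obtain ⟨T, hT1, hT2⟩ := h3 b hb
      exact ⟨T, (Extends.table _ _).trans hT1, hT2⟩

end Rounds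

/-! ### Relations over `τ_k` -/

section Relations
variable {inα inβ : A → Bool} {α β : Set A}

theorem tracks_ofFn {k : ℕ} (y : Fin (3 * k) → Option A) :
    ∃ b : Bool, tracks inα inβ (List.ofFn y) = ⟨0, false, false, b⟩ ∧
      (b = true ↔ ∀ i : Fin k, (∃ p : Fin 3, ∃ a, y ⟨3 * i + p, by omega⟩ = some a ∧ inα a = false) ∧
        ∃ p : Fin 3, ∃ a, y ⟨3 * i + p, by omega⟩ = some a ∧ inβ a = false) := by
  obtain ⟨b, h1, h2⟩ :=
    tracks_range inα inβ (fun j => if h : j < 3 * k then y ⟨j, h⟩ else none) k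
  have hl : List.ofFn y = (List.range (3 * k)).map
      fun j => if h : j < 3 * k then y ⟨j, h⟩ else none := by
    refine List.ext_getElem (by simp) fun i hi _ => ?_
    have : i < 3 * k := by simpa using hi
    simp [this]
  refine ⟨b, by rw [hl, h1], h2.trans ?_⟩
  constructor
  · intro h i
    obtain ⟨⟨p, hp, a, ha, ha'⟩, q, hq, a2, hb, hb'⟩ := h i i.isLt
    have := i.isLt
    rw [dif_pos (by omega)] at ha hb
    exact ⟨⟨⟨p, hp⟩, a, ha, ha'⟩, ⟨q, hq⟩, a2, hb, hb'⟩
  · intro h i hi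
    obtain ⟨⟨p, a, ha, ha'⟩, q, a2, hb, hb'⟩ := h ⟨i, hi⟩
    refine ⟨⟨p, p.isLt, a, ?_, ha'⟩, q, q.isLt, a2, ?_, hb'⟩
    · rw [dif_pos (by have := p.isLt; omega)]; exact ha
    · rw [dif_pos (by have := q.isLt; omega)]; exact hb

/-- Known values that refute every triple refute the relation. -/
theorem notMem_tau_of_fail (hα : ∀ a, inα a = true ↔ a ∈ α) (hβ : ∀ a, inβ a = true ↔ a ∈ β)
    {k : ℕ} {y : Fin (3 * k) → Option A} {x : Fin (3 * k) → A}
    (hy : ∀ j a, y j = some a → x j = a) (h : (tracks inα inβ (List.ofFn y)).fail = true) :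
    x ∉ tau α β k := by
  obtain ⟨b, h1, h2⟩ := tracks_ofFn (inα := inα) (inβ := inβ) y
  rw [h1] at h
  rintro ⟨i, hi⟩
  obtain ⟨⟨p, a, ha, ha'⟩, q, a2, hb, hb'⟩ := h2.1 h i
  have hxa := hy _ _ ha
  have hxb := hy _ _ hb
  have hna : a ∉ α := fun h => by simp [(hα a).2 h] at ha'
  have hnb : a2 ∉ β := fun h => by simp [(hβ a2).2 h] at hb'
  rw [← hxa] at hna
  rw [← hxb] at hnb
  rcases hi with ⟨u, v, w⟩ | ⟨u, v, w⟩
  · fin_cases p <;> contradiction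
  · fin_cases q <;> contradiction

/-- If the known values do not refute some triple, the relation holds where the unknown values
are in `α ∩ β`. -/
theorem mem_tau_of_fail (hα : ∀ a, inα a = true ↔ a ∈ α) (hβ : ∀ a, inβ a = true ↔ a ∈ β)
    {k : ℕ} {y : Fin (3 * k) → Option A} {x : Fin (3 * k) → A}
    (hy : ∀ j, y j = some (x j) ∨ x j ∈ α ∩ β)
    (h : (tracks inα inβ (List.ofFn y)).fail = false) : x ∈ tau α β k := by
  obtain ⟨b, h1, h2⟩ := tracks_ofFn (inα := inα) (inβ := inβ) y
  rw [h1] at h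
  have h : b = false := h
  have := mt h2.2 (by simp [h])
  push Not at this
  obtain ⟨i, hi⟩ := this
  refine ⟨i, ?_⟩
  by_cases hA : ∃ p : Fin 3, ∃ a, y ⟨3 * i + p, by omega⟩ = some a ∧ inα a = false
  · have hB : ∀ p : Fin 3, x ⟨3 * i + p, by omega⟩ ∈ β := fun p => by
      rcases hy ⟨3 * i + p, by omega⟩ with h | h
      · have := hi hA p _ h
        rw [← hβ]; simpa using this
      · exact h.2
    exact .inr ⟨hB 0, hB 1, hB 2⟩
  · have hB : ∀ p : Fin 3, x ⟨3 * i + p, by omega⟩ ∈ α := fun p => by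
      rcases hy ⟨3 * i + p, by omega⟩ with h | h
      · push Not at hA
        have := hA p _ h
        rw [← hα]; simpa using this
      · exact h.1
    exact .inl ⟨hB 0, hB 1, hB 2⟩

theorem map_getD_range (r : ℕ) (X : List A) (c : A) :
    ((List.range r).map fun j => some (X.getD j c)) =
      List.ofFn fun j : Fin r => some (X.getD j c) := by
  refine List.ext_getElem (by simp) fun i hi _ => by simp

end Relations

/-! ### Soundness of the verifier -/

/-- The assignment given by a table, with `e` for the values that are left open, and `b` for
the missing ones. -/
def complete (T₀ : List (Val A)) (b e : A) {n : ℕ} (i : Fin n) : A :=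
  (T₀.getD i none).elim b (·.getD e)

theorem Connected.eval_eq {φ : Sentence A} {s t : Term A φ.numVars} (h : Connected φ s t)
    {x : Fin φ.numVars → A} (hx : ∀ a ∈ φ.matrix, a.Holds x) : s.eval x = t.eval x := by
  induction h with
  | rel s t h => exact hx _ h
  | refl => rfl
  | symm _ _ _ ih => exact ih.symm
  | trans _ _ _ _ _ ih ih' => exact ih.trans ih'

section
variable {φ : Sentence A} {g : (Fin φ.numVars → A) → Fin φ.numVars → A} {T₀ : List (Val A)}

/-- The equalities of the matrix hold in every play, so all terms of a class have the value of the
root, and a universal root is played as the table prescribes. -/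
theorem Derives.eval_eq (hg : IsStrategy φ.quant g) (hP : ∀ u, ∀ a ∈ φ.matrix, a.Holds (g u))
    {t : Term A φ.numVars} {w : Option A} (h : Derives φ T₀ t w) (b e : A) :
    t.eval (g (complete T₀ b e)) = w.getD e := by
  obtain ⟨s, hst, hs⟩ := h
  rw [← hst.eval_eq (hP _)]
  cases s with
  | const a => cases hs; rfl
  | var i =>
    obtain ⟨hq, hi⟩ := hs
    simp only [Term.eval, hg.all _ i hq, complete, hi, Option.elim_some]

/-- The element `e` standing for "open" is arbitrary; with two elements available it can be chosen
to separate an open value from a definite one. -/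
theorem Derives.unique [Nontrivial A] (hg : IsStrategy φ.quant g)
    (hP : ∀ u, ∀ a ∈ φ.matrix, a.Holds (g u)) {t : Term A φ.numVars} {w w' : Option A}
    (h : Derives φ T₀ t w) (h' : Derives φ T₀ t w') : w = w' := by
  have key : ∀ e, w.getD e = w'.getD e := fun e =>
    (h.eval_eq hg hP e e).symm.trans (h'.eval_eq hg hP e e)
  cases w with
  | none =>
    cases w' with
    | none => rfl
    | some a => obtain ⟨e, he⟩ := exists_ne a; exact absurd (key e) he
  | some a =>
    cases w' with
    | none => obtain ⟨e, he⟩ := exists_ne a; exact absurd (key e).symm he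
    | some b => exact congrArg some (key a)

/-- If nothing before `v` were open, completing the table with `e` or with `e'` would give the same
assignment before `v`. The strategy would then play the same value at `v`, which would be both `e`
and `e'`. -/
theorem Derives.exists_lt [Nontrivial A] (hg : IsStrategy φ.quant g)
    (hP : ∀ u, ∀ a ∈ φ.matrix, a.Holds (g u)) {v : Fin φ.numVars} (hv : φ.quant v = .ex)
    (h : Derives φ T₀ (.var v) none) : ∃ i < v, T₀.getD i none = some none := by
  by_contra hno
  push Not at hno
  obtain ⟨e, e', hne⟩ := exists_pair_ne A
  have h1 := h.eval_eq hg hP e e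
  have h2 := h.eval_eq hg hP e e'
  refine hne (h1.symm.trans (Eq.trans ?_ h2))
  refine hg.ex _ _ v hv fun j hj => ?_
  have := hno j hj
  unfold complete
  generalize T₀.getD j none = z at this ⊢
  rcases z with _ | _ | a
  · rfl
  · exact (this rfl).elim
  · rfl

theorem openEx_eq_false [Nontrivial A] (hg : IsStrategy φ.quant g)
    (hP : ∀ u, ∀ a ∈ φ.matrix, a.Holds (g u)) {T : List (Val A)} (hT : Sound φ T₀ T)
    (hext : Extends T₀ T) : openEx (List.ofFn φ.quant) T = false := by
  rw [Bool.eq_false_iff, ne_eq, openEx_eq_true_iff]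
  rintro ⟨v, hv, hTv, hno⟩
  obtain ⟨hlt, hv⟩ := List.getElem?_eq_some_iff.1 hv
  rw [List.getElem_ofFn] at hv
  rw [List.length_ofFn] at hlt
  obtain ⟨i, hi, hi'⟩ := Derives.exists_lt hg hP hv (hT ⟨v, hlt⟩ none hTv)
  exact hno i hi (hext.getD hi')

theorem refutes_eq_false [DecidableEq A] [Nontrivial A] {α β : Set A} {inα inβ : A → Bool}
    (hα : ∀ a, inα a = true ↔ a ∈ α) (hβ : ∀ a, inβ a = true ↔ a ∈ β)
    {c : A} {X : List A}
    (hover : φ.Over (tauLanguage α β)) (hg : IsStrategy φ.quant g)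
    (hP : ∀ u, ∀ a ∈ φ.matrix, a.Holds (g u)) {T : List (Val A)} (hT : Sound φ T₀ T)
    {a : Atom A φ.numVars} (ha : a ∈ φ.matrix) : a.refutes inα inβ c X T = false := by
  cases a with
  | eq s t =>
    exact (Sound.foldl_merge _ (connected_of_mem ha) (T, none, false) hT (by simp)).2
      (fun _ _ _ h h' => Derives.unique hg hP h h') rfl
  | rel r f args =>
    obtain ⟨k, rfl, hk⟩ := exists_eq_tau_of_mem (hover _ _ _ ha)
    have hk : f.relation = tau α β k := hk
    simp only [Atom.refutes, Bool.or_eq_false_iff, decide_eq_false_iff_not, not_not,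
      List.map_ofFn, map_getD_range]
    refine ⟨⟨?_, ?_⟩, ?_⟩
    · obtain ⟨b, hb, -⟩ := tracks_ofFn (inα := inα) (inβ := inβ)
        ((fun t : Term A φ.numVars => (t.lookup T).join) ∘ args)
      rw [hb]
    · by_contra hfail
      rw [Bool.not_eq_false] at hfail
      -- The definite values known for the arguments are their values in this play, where the atom
      -- holds. Any elements could replace `c` here.
      refine notMem_tau_of_fail hα hβ (x := fun i => (args i).eval (g (complete T₀ c c))) ?_ hfail ?_
      · intro j a hj
        have : (args j).lookup T = some (some a) := by
          simpa [Option.join_eq_some_iff] using hj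
        exact (hT.lookup this).eval_eq hg hP c c
      · rw [← hk]
        exact hP _ _ ha
    -- On a tuple without unknown entries the tracker decides `τ_k` exactly, and `f` defines `τ_k`.
    · rw [← Bool.not_eq_true, beq_iff_eq]
      cases hf : (tracks inα inβ (List.ofFn fun j : Fin (3 * k) => some (X.getD j c))).fail with
      | true =>
        intro hv
        have := notMem_tau_of_fail hα hβ (x := fun j => X.getD j c) (by simp) hf
        rw [← hk, ← QF.val_eq_true, hv] at this
        exact this rfl
      | false =>
        have := mem_tau_of_fail hα hβ (x := fun j => X.getD j c) (fun j => .inl rfl) hf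
        rw [← hk, ← QF.val_eq_true] at this
        simp only [this]; simp

end

/-- After the reset only universal variables have values, and each is its own root. A certificate
thus cannot dictate existential values. -/
theorem sound_reset (φ : Sentence A) (T : List (Val A)) :
    Sound φ (reset (List.ofFn φ.quant) T) (reset (List.ofFn φ.quant) T) := by
  intro i w h
  refine ⟨_, .refl _, ?_, h⟩
  have := getD_reset h
  cases hq : φ.quant i with
  | all => rfl
  | ex => simp [hq] at this

/-- No certificate is accepted for a yes-instance. -/
theorem verify_eq_false [DecidableEq A] [Nontrivial A] {α β : Set A} {inα inβ : A → Bool}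
    (hα : ∀ a, inα a = true ↔ a ∈ α) (hβ : ∀ a, inβ a = true ↔ a ∈ β)
    {c : A} {φ : Sentence A} (h : QCSP (tauLanguage α β) φ) (w : List (Cert A)) :
    verify inα inβ c (φ, w) = false := by
  obtain ⟨hover, h⟩ := h
  obtain ⟨g, hg, hP⟩ := QuantHolds.exists_strategy h
  unfold verify
  set T₀ := reset (List.ofFn φ.quant) (w.filterMap Cert.entry?).reverse with hT₀
  set X := (w.filterMap Cert.asg?).reverse
  suffices ∀ m, Sound φ T₀ ((round inα inβ c X φ)^[m] (T₀, false)).1 ∧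
      Extends T₀ ((round inα inβ c X φ)^[m] (T₀, false)).1 ∧
      ((round inα inβ c X φ)^[m] (T₀, false)).2 = false from (this _).2.2
  intro m
  induction m with
  | zero => exact ⟨sound_reset φ _, .refl _, rfl⟩
  | succ m ih =>
    rw [Function.iterate_succ_apply']
    obtain ⟨h1, h2, h3⟩ := ih
    generalize (round inα inβ c X φ)^[m] (T₀, false) = s at h1 h2 h3 ⊢
    unfold round
    refine ⟨Sound.foldl_atomStep φ.matrix (fun _ h => h) (s.1, s.2 || openEx _ s.1) h1,
      h2.trans (Extends.foldl_atomStep _ (s.1, s.2 || openEx _ s.1)), ?_⟩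
    refine foldl_atomStep_eq_false φ.matrix (fun _ h => h) _ h1 ?_ fun a ha T hT =>
      refutes_eq_false hα hβ hover hg hP hT ha
    simp only [h3, Bool.false_or]
    exact openEx_eq_false hg hP h1 h2

/-! ### Completeness of the verifier -/

/-- Otherwise `f` would drop by at least one in each of `n + 1` steps, starting from a value at most
`n`. -/
theorem exists_eq_succ_of_antitone {f : ℕ → ℕ} (hf : ∀ m, f (m + 1) ≤ f m) {n : ℕ} (hn : f 0 ≤ n) :
    ∃ m ≤ n, f (m + 1) = f m := by
  by_contra h
  push Not at h
  have key : ∀ m ≤ n + 1, f m + m ≤ f 0 := by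
    intro m
    induction m with
    | zero => simp
    | succ m ih =>
      intro hm
      have h1 := ih (by omega)
      have h2 := h m (by omega)
      have h3 := hf m
      omega
  have := key (n + 1) le_rfl
  omega

section
variable [DecidableEq A] {inα inβ : A → Bool} {c : A} {X : List A}

theorem Extends.round (φ : Sentence A) (s : List (Val A) × Bool) :
    Extends s.1 (round inα inβ c X φ s).1 :=
  Extends.foldl_atomStep φ.matrix (s.1, s.2 || openEx _ s.1)

theorem Sound.round {φ : Sentence A} {T₀ : List (Val A)} {s : List (Val A) × Bool}
    (h : Sound φ T₀ s.1) : Sound φ T₀ (round inα inβ c X φ s).1 :=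
  Sound.foldl_atomStep φ.matrix (fun _ h => h) (s.1, s.2 || openEx _ s.1) h

theorem round_eq_false {φ : Sentence A} {s : List (Val A) × Bool}
    (h : (round inα inβ c X φ s).2 = false) :
    s.2 = false ∧ openEx (List.ofFn φ.quant) s.1 = false ∧
      ∀ a ∈ φ.matrix, ∃ T, Extends s.1 T ∧ a.refutes inα inβ c X T = false ∧
        Extends (a.table T) (round inα inβ c X φ s).1 := by
  obtain ⟨h1, h2⟩ := of_foldl_atomStep_eq_false _ _ h
  rw [Bool.or_eq_false_iff] at h1
  exact ⟨h1.1, h1.2, h2⟩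

theorem sound_iterate_round {φ : Sentence A} {T₀ : List (Val A)} (hT₀ : Sound φ T₀ T₀) (m : ℕ) :
    Sound φ T₀ ((round inα inβ c X φ)^[m] (T₀, false)).1 ∧
      Extends T₀ ((round inα inβ c X φ)^[m] (T₀, false)).1 := by
  induction m with
  | zero => exact ⟨hT₀, .refl _⟩
  | succ m ih =>
    rw [Function.iterate_succ_apply']
    exact ⟨ih.1.round, ih.2.trans (.round _ _)⟩

/-- If many rounds do not refute the sentence, then one of the tables is stable. -/
theorem exists_stable {φ : Sentence A} {T₀ : List (Val A)} (hT₀ : Sound φ T₀ T₀) {m : ℕ}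
    (hm : T₀.length < m) (h : ((round inα inβ c X φ)^[m] (T₀, false)).2 = false) :
    ∃ T, Sound φ T₀ T ∧ Extends T₀ T ∧ openEx (List.ofFn φ.quant) T = false ∧
      ∀ a ∈ φ.matrix, a.refutes inα inβ c X T = false ∧ a.table T = T := by
  set R := round inα inβ c X φ
  have hfst : ∀ i, Extends (R^[i] (T₀, false)).1 (R^[i + 1] (T₀, false)).1 := fun i => by
    rw [Function.iterate_succ_apply']
    exact .round _ _
  have hback : ∀ i j, (R^[i + j] (T₀, false)).2 = false → (R^[i] (T₀, false)).2 = false := by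
    intro i j
    induction j with
    | zero => exact id
    | succ j ih =>
      intro h
      rw [← add_assoc, Function.iterate_succ_apply'] at h
      exact ih (round_eq_false h).1
  -- Potential argument: some round leaves the number of unknown entries unchanged, hence the whole
  -- table.
  obtain ⟨i, hi, hc⟩ := exists_eq_succ_of_antitone
    (f := fun i => (R^[i] (T₀, false)).1.count none) (fun i => (hfst i).count_le)
    (n := T₀.length) List.count_le_length
  have heq := (hfst i).eq_of_count hc
  have hfalse : (R^[i + 1] (T₀, false)).2 = false := hback _ (m - (i + 1)) (by
    rwa [Nat.add_sub_cancel' (by omega)])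
  obtain ⟨hs, he⟩ := sound_iterate_round (inα := inα) (inβ := inβ) (c := c) (X := X) hT₀ i
  rw [Function.iterate_succ_apply'] at heq hfalse
  obtain ⟨-, h1, h2⟩ := round_eq_false hfalse
  refine ⟨_, hs, he, h1, fun a ha => ?_⟩
  obtain ⟨T, hT1, hT2, hT3⟩ := h2 a ha
  change Extends _ (R (R^[i] (T₀, false))).1 at hT3
  rw [← heq] at hT3
  -- The table before the round and the one after it agree, so the intermediate table of this atom
  -- is squeezed between them.
  obtain rfl := hT1.antisymm ((Extends.table _ _).trans hT3)
  exact ⟨hT2, hT3.antisymm (.table _ _)⟩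

/-! ### Stable tables -/

theorem of_foldl_merge_cons {n : ℕ} {t : Term A n} {l : List (Term A n)} {T : List (Val A)}
    {w : Val A} (h : ((t :: l).foldl merge (T, w, false)).1 = T)
    (hr : ((t :: l).foldl merge (T, w, false)).2.2 = false) :
    t.update T w = T ∧ clash (t.lookup T) w = false ∧
      (l.foldl merge (T, (t.lookup T).or w, false)).1 = T ∧
      (l.foldl merge (T, (t.lookup T).or w, false)).2.2 = false := by
  rw [List.foldl_cons, merge, merge_snd] at h hr
  simp only [Bool.false_or, Bool.or_eq_false_iff] at h hr
  have hu : t.update T w = T := by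
    have h1 := Extends.update T w t
    have h2 := Extends.foldl_merge l (t.update T w, (t.lookup T).or w, false)
    rw [h] at h2
    exact h2.antisymm h1
  rw [hu] at h hr
  exact ⟨hu, hr.1, h, hr.2⟩

/-- The visits `s, t, s` carry a value of `s` to `t` and a value of `t` back to `s`. If this neither
changes the table nor clashes, the two entries were equal already. -/
theorem lookup_eq_of_table_eq {n : ℕ} {T : List (Val A)} (hT : T.length = n) {s t : Term A n}
    (h : (Atom.eq s t).table T = T) (hr : (Atom.eq s t).refutes inα inβ c X T = false) :
    s.lookup T = t.lookup T := by
  have hor : ∀ (u : Term A n) (w : Val A), u.update T w = T → clash (u.lookup T) w = false →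
      ∀ v, w = some v → u.lookup T = some v := by
    rintro u w hu hcl v rfl
    have : ∃ v', u.lookup T = some v' := by
      cases u with
      | const a => exact ⟨some a, rfl⟩
      | var i =>
        have := Term.lookup_update_self hT (some v) (.var i) (by simp)
        rw [hu] at this
        rw [this]
        cases (Term.var i : Term A n).lookup T <;> simp
    obtain ⟨v', hv'⟩ := this
    rw [hv'] at hcl ⊢
    simpa [clash] using hcl
  -- The first visit only picks up the value of `s`; the second and the third give the two
  -- implications. The fourth visit is not needed here.
  obtain ⟨-, -, h, hr⟩ := of_foldl_merge_cons h hr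
  obtain ⟨hu, hc, h, hr⟩ := of_foldl_merge_cons h hr
  obtain ⟨hu', hc', -, -⟩ := of_foldl_merge_cons h hr
  rw [Option.or_none] at hu hc hu' hc'
  have h1 := hor _ _ hu hc
  have h2 := hor _ _ hu' hc'
  cases hs : s.lookup T with
  | some v => exact (h1 v hs).symm
  | none =>
    cases ht : t.lookup T with
    | none => rfl
    | some v =>
      rw [← hs]
      exact h2 v (by rw [ht, hs]; rfl)

end

/-- The certificate with the given table, assignment and number of rounds. -/
def certificate (T : List (Val A)) (X : List A) (m : ℕ) : List (Cert A) :=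
  T.reverse.map .entry ++ X.reverse.map .asg ++ List.replicate m .tick

theorem length_certificate (T : List (Val A)) (X : List A) (m : ℕ) :
    (certificate T X m).length = T.length + X.length + m := by
  simp [certificate, add_assoc]

theorem verify_certificate [DecidableEq A] (inα inβ : A → Bool) (c : A) (φ : Sentence A)
    (T : List (Val A)) (X : List A) (m : ℕ) :
    verify inα inβ c (φ, certificate T X m) =
      ((round inα inβ c X φ)^[m] (reset (List.ofFn φ.quant) T, false)).2 := by
  have h1 : ∀ l : List (Val A), (l.map Cert.entry).filterMap Cert.entry? = l := fun l => by
    rw [List.filterMap_map]; exact List.filterMap_some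
  have h2 : ∀ l : List (Val A), (l.map Cert.entry).filterMap Cert.asg? = [] := fun l => by
    simp [List.filterMap_eq_nil_iff, Cert.asg?]
  have h3 : ∀ l : List (Val A), (l.map Cert.entry).filterMap Cert.tick? = [] := fun l => by
    simp [List.filterMap_eq_nil_iff, Cert.tick?]
  have h4 : ∀ l : List A, (l.map Cert.asg).filterMap Cert.entry? = [] := fun l => by
    simp [List.filterMap_eq_nil_iff, Cert.entry?]
  have h5 : ∀ l : List A, (l.map Cert.asg).filterMap Cert.asg? = l := fun l => by
    rw [List.filterMap_map]; exact List.filterMap_some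
  have h6 : ∀ l : List A, (l.map Cert.asg).filterMap Cert.tick? = [] := fun l => by
    simp [List.filterMap_eq_nil_iff, Cert.tick?]
  have h7 : (List.replicate m (Cert.tick : Cert A)).filterMap Cert.entry? = [] := by
    simp [List.filterMap_eq_nil_iff, Cert.entry?]
  have h8 : (List.replicate m (Cert.tick : Cert A)).filterMap Cert.asg? = [] := by
    simp [List.filterMap_eq_nil_iff, Cert.asg?]
  have h9 : (List.replicate m (Cert.tick : Cert A)).filterMap Cert.tick? =
      List.replicate m () := by
    rw [List.filterMap_replicate]; rfl
  simp [verify, certificate, List.filterMap_append, h1, h2, h3, h4, h5, h6, h7, h8, h9]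

/-! ### Lengths of codes -/

theorem Term.length_encode_pos {n : ℕ} (t : Term A n) : 0 < t.encode.length := by
  cases t <;> simp [Term.encode]

theorem length_le_flatMap_encode {n : ℕ} (l : List (Term A n)) :
    l.length ≤ (l.flatMap Term.encode).length := by
  induction l with
  | nil => simp
  | cons t l ih =>
    have := t.length_encode_pos
    simp only [List.flatMap_cons, List.length_append, List.length_cons]
    omega

theorem numVars_le_length_encode (φ : Sentence A) : φ.numVars ≤ φ.encode.length := by
  simp [Sentence.encode]

theorem arity_le_length_encode {φ : Sentence A} {r : ℕ} {f : QF A r}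
    {args : Fin r → Term A φ.numVars} (h : Atom.rel r f args ∈ φ.matrix) :
    r ≤ φ.encode.length := by
  have h1 : r ≤ (Atom.rel r f args).encode.length := by
    have := length_le_flatMap_encode (List.ofFn args)
    rw [List.length_ofFn] at this
    simp only [Atom.encode, List.length_append]
    omega
  have h2 : (Atom.rel r f args).encode.length ≤ (φ.matrix.flatMap Atom.encode).length := by
    rw [List.length_flatMap]
    exact List.single_le_sum (by simp) _ (List.mem_map_of_mem (f := fun a => a.encode.length) h)
  simp only [Sentence.encode, List.length_append]
  omega

/-- The table with the values `y` at the universal variables. -/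
def univTable (φ : Sentence A) (y : Fin φ.numVars → Val A) : List (Val A) :=
  List.ofFn fun i => match φ.quant i with
    | .all => y i
    | .ex => none

theorem getD_univTable {φ : Sentence A} (y : Fin φ.numVars → Val A) (i : Fin φ.numVars) :
    (univTable φ y).getD i none = match φ.quant i with
      | .all => y i
      | .ex => none := by
  simp [univTable, List.getD_eq_getElem?_getD]

theorem derives_univTable {φ : Sentence A} {y : Fin φ.numVars → Val A} {t : Term A φ.numVars}
    {w : Option A} : Derives φ (univTable φ y) t w ↔
      (∃ a, Connected φ (.const a) t ∧ w = some a) ∨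
        ∃ k, φ.quant k = .all ∧ Connected φ (.var k) t ∧ y k = some w := by
  constructor
  · rintro ⟨s, hst, hs⟩
    cases s with
    | const a => exact .inl ⟨a, hst, hs⟩
    | var k =>
      obtain ⟨hk, hs⟩ := hs
      rw [getD_univTable] at hs
      simp only [hk] at hs
      exact .inr ⟨k, hk, hst, hs⟩
  · rintro (⟨a, hst, hs⟩ | ⟨k, hk, hst, hs⟩)
    · exact ⟨_, hst, hs⟩
    · refine ⟨_, hst, hk, ?_⟩
      rw [getD_univTable]
      simpa only [hk] using hs

theorem Connected.lookup_eq {φ : Sentence A} {T : List (Val A)}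
    (h : ∀ s t, Atom.eq s t ∈ φ.matrix → s.lookup T = t.lookup T) {s t : Term A φ.numVars}
    (hst : Connected φ s t) : s.lookup T = t.lookup T := by
  induction hst with
  | rel s t hst => exact h s t hst
  | refl => rfl
  | symm _ _ _ ih => exact ih.symm
  | trans _ _ _ _ _ ih ih' => exact ih.trans ih'

/-- If no short certificate is accepted, we have a yes-instance. -/
theorem qcsp_of_verify_eq_false [DecidableEq A] {α β : Set A} {inα inβ : A → Bool}
    (hα : ∀ a, inα a = true ↔ a ∈ α) (hβ : ∀ a, inβ a = true ↔ a ∈ β) {c : A} (hc : c ∈ α ∩ β)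
    {φ : Sentence A}
    (h : ∀ w : List (Cert A), w.length ≤ 3 * φ.encode.length + 1 →
      verify inα inβ c (φ, w) = false) :
    QCSP (tauLanguage α β) φ := by
  have : Nonempty A := ⟨c⟩
  have hrun : ∀ (T : List (Val A)) (X : List A), T.length = φ.numVars →
      (∀ i : Fin φ.numVars, φ.quant i = .ex → T.getD i none = none) →
      X.length ≤ φ.encode.length → ∃ T', Sound φ T T' ∧ Extends T T' ∧
        openEx (List.ofFn φ.quant) T' = false ∧
        ∀ a ∈ φ.matrix, a.refutes inα inβ c X T' = false ∧ a.table T' = T' := by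
    intro T X hT hex hX
    have hreset : reset (List.ofFn φ.quant) T = T := reset_eq_self fun i hi => by
      obtain ⟨hlt, hi⟩ := List.getElem?_eq_some_iff.1 hi
      rw [List.getElem_ofFn] at hi
      exact hex _ hi
    -- One round more than there are entries to fill. The table, the tuple and the ticks have at
    -- most `n`, `|φ|` and `n + 1` symbols, and `n ≤ |φ|`; this is the bound `3 * |φ| + 1`.
    have hv := h (certificate T X (φ.numVars + 1)) (by
      have := numVars_le_length_encode φ
      rw [length_certificate]
      omega)
    rw [verify_certificate, hreset] at hv
    refine exists_stable ?_ (by omega) hv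
    have := sound_reset φ T
    rwa [hreset] at this
  have hover : φ.Over (tauLanguage α β) := by
    intro r f args hmem
    have key : ∀ x : Fin r → A, r % 3 = 0 ∧
        (f.val x == (tracks inα inβ (List.ofFn fun j => some (x j))).fail) = false := by
      intro x
      -- The table is irrelevant for testing a formula, so it starts empty; the certificate supplies
      -- the tuple `x`.
      obtain ⟨T, -, -, -, hT⟩ := hrun (List.replicate φ.numVars none) (List.ofFn x) (by simp)
        (fun i _ => by simp [List.getD_eq_getElem?_getD])
        (by simpa using arity_le_length_encode hmem)
      have := (hT _ hmem).1
      have hx : ∀ j : Fin r, (List.ofFn x).getD j c = x j := fun j => by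
        simp [List.getD_eq_getElem?_getD]
      simp only [Atom.refutes, Bool.or_eq_false_iff, map_getD_range, hx,
        decide_eq_false_iff_not, not_not] at this
      refine ⟨?_, this.2⟩
      have hphase := phase_tracks inα inβ ((List.ofFn args).map fun t => (t.lookup T).join)
      rw [this.1.1] at hphase
      simpa using hphase.symm
    obtain ⟨k, rfl⟩ : 3 ∣ r := Nat.dvd_of_mod_eq_zero (key fun _ => c).1
    have hf : f.relation = tau α β k := by
      ext x
      have hx := (key x).2
      rw [← QF.val_eq_true]
      cases hfail : (tracks inα inβ (List.ofFn fun j => some (x j))).fail with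
      | true =>
        rw [hfail] at hx
        have := notMem_tau_of_fail hα hβ (x := x) (by simp) hfail
        simp_all
      | false =>
        rw [hfail] at hx
        have := mem_tau_of_fail hα hβ (x := x) (fun j => .inl rfl) hfail
        simp_all
    exact ⟨k, by rw [hf]⟩
  refine ⟨hover, ?_⟩
  -- Stability turns soundness into an equivalence: the table is constant on classes, so every
  -- derived value has arrived.
  · have hstable : ∀ y : Fin φ.numVars → Val A, ∃ T,
        (∀ t w, t.lookup T = some w ↔ Derives φ (univTable φ y) t w) ∧
        openEx (List.ofFn φ.quant) T = false ∧
        (∀ s t, Atom.eq s t ∈ φ.matrix → s.lookup T = t.lookup T) ∧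
        ∀ a ∈ φ.matrix, a.refutes inα inβ c [] T = false := by
      intro y
      obtain ⟨T, hs, he, ho, ha⟩ := hrun (univTable φ y) [] (by simp [univTable])
        (fun i hi => by rw [getD_univTable]; simp only [hi]) (by simp)
      have heq : ∀ s t, Atom.eq s t ∈ φ.matrix → s.lookup T = t.lookup T := fun s t hst =>
        lookup_eq_of_table_eq (by rw [← he.length_eq]; simp [univTable]) (ha _ hst).2 (ha _ hst).1
      refine ⟨T, fun t w => ⟨hs.lookup, ?_⟩, ho, heq, fun a h => (ha a h).1⟩
      rintro ⟨s, hst, hw⟩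
      rw [← Connected.lookup_eq heq hst]
      cases s with
      | const a => rw [hw]; rfl
      | var k => exact he.getD hw.2
    choose T hT using hstable
    -- The strategy plays the stable table of the total universal assignment `u`, and `c` where that
    -- table knows nothing.
    let T' := fun u : Fin φ.numVars → A => T fun i => some (some (u i))
    have heval : ∀ (u : Fin φ.numVars → A) (t : Term A φ.numVars),
        t.eval (fun i => ((Term.var i : Term A φ.numVars).lookup (T' u)).join.getD c) =
          (t.lookup (T' u)).join.getD c := fun u t => by
      cases t <;> rfl
    refine IsStrategy.quantHolds
      (g := fun u i => ((Term.var i : Term A φ.numVars).lookup (T' u)).join.getD c)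
      ⟨fun u i hi => ?_, fun u u' v hv huu => ?_⟩ fun u a ha => ?_
    · have : (Term.var i : Term A φ.numVars).lookup (T' u) = some (some (u i)) :=
        ((hT _).1 _ _).2 (derives_univTable.2 (.inr ⟨i, hi, .refl _, rfl⟩))
      simp [this]
    -- The value at `v` must not depend on later variables. If it comes from a universal variable
    -- `k`, it suffices to find a universal variable of the same class before `v`, where `u` and
    -- `u'` agree.
    · have main : ∀ u u' : Fin φ.numVars → A, (∀ j < v, u j = u' j) → ∀ w,
          (Term.var v : Term A φ.numVars).lookup (T' u) = some w →
          (Term.var v : Term A φ.numVars).lookup (T' u') = some w := by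
        intro u u' huu w hw
        refine ((hT _).1 _ _).2 (derives_univTable.2 ?_)
        rcases derives_univTable.1 (((hT _).1 _ _).1 hw) with hroot | ⟨k, hk, hkv, huk⟩
        · exact .inl hroot
        · right
          suffices ∃ i < v, φ.quant i = .all ∧ Connected φ (.var i) (.var v) by
            obtain ⟨i, hi, hqi, hiv⟩ := this
            refine ⟨i, hqi, hiv, ?_⟩
            rw [← huu i hi, ← hw]
            exact (((hT _).1 _ _).2 (derives_univTable.2 (.inr ⟨i, hqi, hiv, rfl⟩))).symm
          -- With only `k` open, the open entries are exactly the variables in the class of `k`,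
          -- among them `v`. The first of them is universal, because the table is not refuted, and
          -- so it is strictly before `v`.
          obtain ⟨hstar, hopen, -⟩ := hT fun i => if i = k then some none else none
          have hex : ∃ i, (T fun i => if i = k then some none else none).getD i none =
              some none := ⟨v, (hstar (.var v) none).2
            (derives_univTable.2 (.inr ⟨k, hk, hkv, by simp⟩))⟩
          obtain ⟨i, hi, hmin⟩ : ∃ i, (T fun i => if i = k then some none else none).getD i none =
              some none ∧ ∀ j < i, (T fun i => if i = k then some none else none).getD j none ≠
              some none := ⟨Nat.find hex, Nat.find_spec hex, fun j hj => Nat.find_min hex hj⟩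
          have hiv : i ≤ v := by
            by_contra hlt
            exact hmin v (by omega) ((hstar (.var v) none).2
              (derives_univTable.2 (.inr ⟨k, hk, hkv, by simp⟩)))
          have hin : i < φ.numVars := by omega
          have hki : Connected φ (.var k) (.var ⟨i, hin⟩) := by
            rcases derives_univTable.1 ((hstar (.var ⟨i, hin⟩) none).1 hi) with
              ⟨a, _, ha⟩ | ⟨k', _, hk', hy⟩
            · cases ha
            · split_ifs at hy with hkk
              exact hkk ▸ hk'
          have hqi : φ.quant ⟨i, hin⟩ = .all := by
            cases hqi : φ.quant ⟨i, hin⟩ with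
            | all => rfl
            | ex =>
              refine absurd ((openEx_eq_true_iff _ _).2 ⟨i, ?_, hi, hmin⟩) (by rw [hopen]; simp)
              simp [hin, hqi]
          refine ⟨⟨i, hin⟩, lt_of_le_of_ne hiv ?_, hqi, (hki.symm _ _).trans _ _ _ hkv⟩
          rintro rfl
          simp [hv] at hqi
      have : (Term.var v : Term A φ.numVars).lookup (T' u) =
          (Term.var v : Term A φ.numVars).lookup (T' u') := by
        refine Option.ext fun w => ⟨main u u' huu w, main u' u (fun j hj => (huu j hj).symm) w⟩
      simp only [this]
    · cases a with
      | eq s t =>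
        change s.eval _ = t.eval _
        rw [heval, heval, (hT _).2.2.1 s t ha]
      | rel r f args =>
        obtain ⟨k, rfl, hk⟩ := exists_eq_tau_of_mem (hover _ _ _ ha)
        have hk : f.relation = tau α β k := hk
        have hr := (hT fun i => some (some (u i))).2.2.2 _ ha
        simp only [Atom.refutes, Bool.or_eq_false_iff, List.map_ofFn] at hr
        change _ ∈ f.relation
        rw [hk]
        refine mem_tau_of_fail hα hβ (fun j => ?_) hr.1.2
        rw [heval]
        dsimp only [Function.comp]
        -- Unknown arguments are played `c`, which lies in `α ∩ β` and so can spoil no triple.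
        cases ((args j).lookup (T' u)).join with
        | none => exact .inr hc
        | some b => exact .inl rfl

/-! ### The verifier as a Turing machine: stacks, registers and labels -/

inductive Stack : Type
  | inp | rd | tab | tab' | asg | asg' | bools | clk | out
  deriving DecidableEq

@[reducible] def Stack.Symbol (A : Type) : Stack → Type
  | .inp => Tok A ⊕ Cert A
  | .rd => Tok A
  | .tab => Val A
  | .tab' => Val A
  | .asg => A
  | .asg' => A
  | .bools => Bool
  | .clk => Unit
  | .out => Bool

/-- The contents of the stacks. The input is on `inp`, and what has been read of it is on `rd`.
The first entries of the table and of the assignment are moved to `tab'` and `asg'` when a position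
is looked up. The stack `clk` counts the rounds. -/
structure Stacks (A : Type) : Type where
  inp : List (Tok A ⊕ Cert A)
  rd : List (Tok A)
  tab : List (Val A)
  tab' : List (Val A)
  asg : List A
  asg' : List A
  bools : List Bool
  clk : List Unit
  out : List Bool

def Stacks.get (s : Stacks A) : ∀ k, List (Stack.Symbol A k)
  | .inp => s.inp
  | .rd => s.rd
  | .tab => s.tab
  | .tab' => s.tab'
  | .asg => s.asg
  | .asg' => s.asg'
  | .bools => s.bools
  | .clk => s.clk
  | .out => s.out

/-- The registers. -/
structure Reg (A : Type) : Type where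
  w : Val A
  v₁ : A
  v₂ : A
  known : Tracker
  asgd : Tracker
  first : Bool
  star : Bool
  acc : Bool

/-- The symbols read in the current step. -/
structure Scratch (A : Type) : Type where
  tok : Option (Tok A ⊕ Cert A)
  e : Option (Val A)
  x : Option A
  b : Option Bool
  b' : Option Bool
  clk : Option Unit

/-- The places from which a term is looked up, or from which the table is restored. -/
inductive Place : Type
  | eq₁ | eq₂ | eq₃ | eq₄ | arg | quants
  deriving DecidableEq

inductive Label : Type
  | load | rewind | clock | quants | atoms | unread | args | restore | form | clean
  | term (p : Place)
  | back (p : Place)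

instance : Fintype Stack :=
  ⟨{.inp, .rd, .tab, .tab', .asg, .asg', .bools, .clk, .out}, fun k => by cases k <;> decide⟩

instance : Fintype Place :=
  ⟨{.eq₁, .eq₂, .eq₃, .eq₄, .arg, .quants}, fun p => by cases p <;> decide⟩

instance : Finite Label :=
  Finite.of_surjective (fun x : Fin 10 ⊕ Place ⊕ Place => match x with
    | .inl i => ![.load, .rewind, .clock, .quants, .atoms, .unread, .args, .restore, .form,
        .clean] i
    | .inr (.inl p) => .term p
    | .inr (.inr p) => .back p) (by
    intro l
    cases l
    · exact ⟨.inl 0, rfl⟩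
    · exact ⟨.inl 1, rfl⟩
    · exact ⟨.inl 2, rfl⟩
    · exact ⟨.inl 3, rfl⟩
    · exact ⟨.inl 4, rfl⟩
    · exact ⟨.inl 5, rfl⟩
    · exact ⟨.inl 6, rfl⟩
    · exact ⟨.inl 7, rfl⟩
    · exact ⟨.inl 8, rfl⟩
    · exact ⟨.inl 9, rfl⟩
    · exact ⟨.inr (.inl _), rfl⟩
    · exact ⟨.inr (.inr _), rfl⟩)

instance [Finite A] : Finite (Tok A) :=
  Finite.of_surjective (fun x : Fin 11 ⊕ A => match x with
    | .inl i => ![.all, .ex, .tick, .var, .eq, .neg, .and, .or, .rel, .colon, .close] i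
    | .inr a => Tok.const a) (by
    intro t
    cases t
    · exact ⟨.inl 0, rfl⟩
    · exact ⟨.inl 1, rfl⟩
    · exact ⟨.inl 2, rfl⟩
    · exact ⟨.inl 3, rfl⟩
    · exact ⟨.inl 4, rfl⟩
    · exact ⟨.inl 5, rfl⟩
    · exact ⟨.inl 6, rfl⟩
    · exact ⟨.inl 7, rfl⟩
    · exact ⟨.inl 8, rfl⟩
    · exact ⟨.inl 9, rfl⟩
    · exact ⟨.inl 10, rfl⟩
    · exact ⟨.inr _, rfl⟩)

instance [Finite A] : Finite (Cert A) :=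
  Finite.of_surjective (fun x : Val A ⊕ A ⊕ Unit => match x with
    | .inl e => Cert.entry e
    | .inr (.inl a) => .asg a
    | .inr (.inr _) => .tick) (by
    intro t
    cases t
    · exact ⟨.inl _, rfl⟩
    · exact ⟨.inr (.inl _), rfl⟩
    · exact ⟨.inr (.inr ()), rfl⟩)

instance : Finite Tracker :=
  Finite.of_injective (fun k : Tracker => (k.phase, k.outα, k.outβ, k.fail)) (by
    rintro ⟨⟩ ⟨⟩ h
    simp_all)

instance [Finite A] : Finite (Reg A) :=
  Finite.of_injective
    (fun r : Reg A => (r.w, r.v₁, r.v₂, r.known, r.asgd, r.first, r.star, r.acc)) (by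
    rintro ⟨⟩ ⟨⟩ h
    simp_all)

instance [Finite A] : Finite (Scratch A) :=
  Finite.of_injective
    (fun s : Scratch A => (s.tok, s.e, s.x, s.b, s.b', s.clk)) (by
    rintro ⟨⟩ ⟨⟩ h
    simp_all)

/-! ### The program -/

open Turing.TM2 (Stmt stepAux)

abbrev Prog (A : Type) : Type := Stmt (Stack.Symbol A) Label (Reg A × Scratch A)

def defaultSymbol (c : A) : ∀ k, Stack.Symbol A k
  | .inp => .inl .all
  | .rd => .all
  | .tab => none
  | .tab' => none
  | .asg => c
  | .asg' => c
  | .bools => false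
  | .clk => ()
  | .out => false

/-- Push a symbol if there is one. -/
def pushOpt (c : A) (k : Stack) (f : Reg A × Scratch A → Option (Stack.Symbol A k)) (q : Prog A) :
    Prog A :=
  .branch (fun v => (f v).isSome) (.push k (fun v => (f v).getD (defaultSymbol c k)) q) q

theorem stepAux_pushOpt (c : A) (k : Stack) (f : Reg A × Scratch A → Option (Stack.Symbol A k))
    (q : Prog A) (v : Reg A × Scratch A) (S : ∀ k, List (Stack.Symbol A k)) :
    stepAux (pushOpt c k f q) v S =
      stepAux q v (Function.update S k ((f v).toList ++ S k)) := by
  cases h : f v <;> simp [pushOpt, h]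

def popInp (q : Prog A) : Prog A := .pop .inp (fun v t => (v.1, { v.2 with tok := t })) q

def popRd (q : Prog A) : Prog A :=
  .pop .rd (fun v t => (v.1, { v.2 with tok := t.map .inl })) q

def popTab (q : Prog A) : Prog A := .pop .tab (fun v e => (v.1, { v.2 with e := e })) q

def popTab' (q : Prog A) : Prog A := .pop .tab' (fun v e => (v.1, { v.2 with e := e })) q

def popAsg (q : Prog A) : Prog A := .pop .asg (fun v x => (v.1, { v.2 with x := x })) q

def popAsg' (q : Prog A) : Prog A := .pop .asg' (fun v x => (v.1, { v.2 with x := x })) q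

def popBools (q : Prog A) : Prog A :=
  .pop .bools (fun v b => (v.1, { v.2 with b := b }))
    (.pop .bools (fun v b => (v.1, { v.2 with b' := b })) q)

def popClk (q : Prog A) : Prog A := .pop .clk (fun v u => (v.1, { v.2 with clk := u })) q

def setReg (f : Reg A → Scratch A → Reg A) (q : Prog A) : Prog A :=
  .load (fun v => (f v.1 v.2, v.2)) q

def goto (f : Scratch A → Label) : Prog A := .goto fun v => f v.2

/-- Leave out the certificate symbols. -/
def tok? : Option (Tok A ⊕ Cert A) → Option (Tok A)
  | some (.inl t) => some t
  | _ => none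

def cert? : Option (Tok A ⊕ Cert A) → Option (Cert A)
  | some (.inr t) => some t
  | _ => none

def quant? : Option (Tok A ⊕ Cert A) → Option Quant
  | some (.inl .all) => some .all
  | some (.inl .ex) => some .ex
  | _ => none

def Reg.init (c : A) : Reg A := ⟨none, c, c, .init, .init, true, false, false⟩

/-- The registers between two atoms. -/
def Reg.base (c : A) (acc : Bool) : Reg A := ⟨none, c, c, .init, .init, false, false, acc⟩

def Place.next : Place → Label
  | .eq₁ => .term .eq₂
  | .eq₂ => .unread
  | .eq₃ => .term .eq₄
  | .eq₄ => .atoms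
  | .arg => .args
  | .quants => .atoms

/-- The reset of existential entries is done while the prefix is read for the first time. -/
def quantEntry (first : Bool) (q : Quant) (e : Val A) : Val A :=
  match first, q with
  | true, .ex => none
  | _, _ => e

def isStar : Option (Val A) → Bool
  | some (some none) => true
  | _ => false

def Quant.isEx : Quant → Bool
  | .ex => true
  | .all => false

/-- `star` remembers that an open entry has been met, so that only the first one can cause
acceptance. The end of the prefix clears it. -/
def quantReg (r : Reg A) (q : Option Quant) (e : Option (Val A)) : Reg A :=
  match q with
  | none => { r with first := false, star := false }
  | some q =>
    let s := isStar (e.map (quantEntry r.first q))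
    { r with star := r.star || s, acc := r.acc || (s && !r.star && q.isEx) }

def termVal (t : Option (Tok A)) (e : Option (Val A)) : Val A :=
  match t with
  | some .var => e.getD none
  | some (.const a) => some (some a)
  | _ => none

section
variable [DecidableEq A] (inα inβ : A → Bool) (c : A)

def Reg.merge (r : Reg A) (v : Val A) : Reg A :=
  { r with w := v.or r.w, acc := r.acc || clash v r.w }

/-- Within an equality the current value has to survive from term to term, up to the fourth lookup.
For an argument it goes to the tracker and is dropped. -/
def Reg.leave (p : Place) (r : Reg A) : Reg A :=
  match p with
  | .eq₄ => { r with w := none }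
  | .arg => { r with w := none, known := r.known.next inα inβ r.w.join }
  | _ => r

/-- `v₁` and `v₂` hold the last two terms read. An equality sets them back to `c`, so that
evaluating a formula leaves the registers as they were. -/
def formReg (r : Reg A) (t : Option (Tok A)) (x : Option A) (b : Option Bool) : Reg A :=
  match t with
  | some .var => { r with v₂ := r.v₁, v₁ := x.getD c }
  | some (.const a) => { r with v₂ := r.v₁, v₁ := a }
  | some .eq => { r with v₁ := c, v₂ := c }
  | some .close => { r with
      acc := r.acc || (decide (r.known.phase ≠ 0) || r.known.fail || (b.getD false == r.asgd.fail)),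
      known := .init, asgd := .init }
  | _ => r

/-- The new top of the stack of truth values. -/
def formBools (r : Reg A) (t : Option (Tok A)) (b b' : Option Bool) : List Bool :=
  match t with
  | some .eq => decide (r.v₂ = r.v₁) :: (b.toList ++ b'.toList)
  | some .neg => (b.map (!·)).toList ++ b'.toList
  | some .and => [b'.getD false && b.getD false]
  | some .or => [b'.getD false || b.getD false]
  | some .close => b'.toList
  | _ => b.toList ++ b'.toList

/-- A pass moves the input from `inp` to `rd`, and `rewind` brings it back. A unary index is
followed by shifting entries to a primed stack, which `back` or `restore` empties again. In an
equality, `unread` returns both terms to the input for their second visits. -/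
def prog : Label → Prog A
  | .load =>
    popInp <|
    pushOpt c .rd (fun v => tok? v.2.tok) <|
    pushOpt c .tab (fun v => (cert? v.2.tok).bind Cert.entry?) <|
    pushOpt c .asg (fun v => (cert? v.2.tok).bind Cert.asg?) <|
    pushOpt c .clk (fun v => (cert? v.2.tok).bind Cert.tick?) <|
    goto fun v => if v.tok.isSome then .load else .rewind
  | .rewind =>
    popRd <|
    pushOpt c .inp (fun v => v.2.tok) <|
    goto fun v => if v.tok.isSome then .rewind else .clock
  | .clock =>
    popClk <|
    goto fun v => if v.clk.isSome then .quants else .clean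
  | .quants =>
    popInp <|
    popTab <|
    pushOpt c .inp (fun v => if (quant? v.2.tok).isSome then none else v.2.tok) <|
    pushOpt c .rd (fun v => if (quant? v.2.tok).isSome then tok? v.2.tok else none) <|
    pushOpt c .tab (fun v => if (quant? v.2.tok).isSome then none else v.2.e) <|
    pushOpt c .tab' (fun v => (quant? v.2.tok).bind fun q => v.2.e.map (quantEntry v.1.first q)) <|
    setReg (fun r s => quantReg r (quant? s.tok) s.e) <|
    goto fun v => if (quant? v.tok).isSome then .quants else .back .quants
  | .back p =>
    popTab' <|
    pushOpt c .tab (fun v => v.2.e) <|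
    setReg (fun r s => if s.e.isSome then r else r.leave inα inβ p) <|
    goto fun v => if v.e.isSome then .back p else p.next
  | .atoms =>
    popInp <|
    pushOpt c .rd (fun v => tok? v.2.tok) <|
    goto fun v => match tok? v.tok with
      | none => .rewind
      | some .eq => .term .eq₁
      | _ => .args
  | .term p =>
    popInp <|
    popTab <|
    pushOpt c .rd (fun v => tok? v.2.tok) <|
    pushOpt c .tab (fun v => match tok? v.2.tok with
      | some .tick => none
      | some .var => v.2.e.map (·.or v.1.w)
      | _ => v.2.e) <|
    pushOpt c .tab' (fun v => match tok? v.2.tok with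
      | some .tick => v.2.e
      | _ => none) <|
    setReg (fun r s => match tok? s.tok with
      | some .tick => r
      | t => r.merge (termVal t s.e)) <|
    goto fun v => match tok? v.tok with
      | some .tick => .term p
      | _ => .back p
  | .unread =>
    popRd <|
    -- Codes of terms do not contain the token `eq`, so it marks where the equality began.
    pushOpt c .rd (fun v => match tok? v.2.tok with
      | some .eq => some .eq
      | _ => none) <|
    pushOpt c .inp (fun v => match tok? v.2.tok with
      | some .eq => none
      | _ => v.2.tok) <|
    goto fun v => match tok? v.tok with
      | some .eq => .term .eq₃
      | _ => .unread
  | .args =>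
    popInp <|
    popAsg <|
    -- Only `colon` is consumed; any other token begins a term and goes back to the input.
    pushOpt c .rd (fun v => match tok? v.2.tok with
      | some .colon => some .colon
      | _ => none) <|
    pushOpt c .inp (fun v => match tok? v.2.tok with
      | some .colon => none
      | _ => v.2.tok) <|
    pushOpt c .asg (fun v => match tok? v.2.tok with
      | some .colon => v.2.x
      | _ => none) <|
    pushOpt c .asg' (fun v => match tok? v.2.tok with
      | some .colon => none
      | _ => v.2.x) <|
    setReg (fun r s => match tok? s.tok with
      | some .colon => r
      | _ => { r with asgd := r.asgd.next inα inβ (some (s.x.getD c)) }) <|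
    goto fun v => match tok? v.tok with
      | some .colon => .restore
      | _ => .term .arg
  | .restore =>
    popAsg' <|
    pushOpt c .asg (fun v => v.2.x) <|
    goto fun v => if v.x.isSome then .restore else .form
  | .form =>
    popInp <|
    popAsg <|
    popBools <|
    pushOpt c .rd (fun v => tok? v.2.tok) <|
    pushOpt c .asg (fun v => match tok? v.2.tok with
      | some .tick => none
      | _ => v.2.x) <|
    pushOpt c .asg' (fun v => match tok? v.2.tok with
      | some .tick => v.2.x
      | _ => none) <|
    pushOpt c .bools (fun v => (formBools v.1 (tok? v.2.tok) v.2.b v.2.b')[2]?) <|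
    pushOpt c .bools (fun v => (formBools v.1 (tok? v.2.tok) v.2.b v.2.b')[1]?) <|
    pushOpt c .bools (fun v => (formBools v.1 (tok? v.2.tok) v.2.b v.2.b')[0]?) <|
    setReg (fun r s => formReg c r (tok? s.tok) s.x s.b) <|
    goto fun v => match tok? v.tok with
      | some .var => .restore
      | some .close => .atoms
      | _ => .form
  | .clean =>
    popInp <|
    popTab <|
    popAsg <|
    .branch (fun v => v.2.tok.isSome || v.2.e.isSome || v.2.x.isSome)
      (goto fun _ => .clean)
      (.push .out (fun v => v.1.acc) <|
        -- A halting configuration must have the initial registers and all stacks but the output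
        -- empty.
        .load (fun _ => (Reg.init c, ⟨none, none, none, none, none, none⟩)) <|
        .halt)

/-! ### Runs of the machine -/

/-- A configuration without the scratch registers. -/
structure Conf (A : Type) : Type where
  label : Label
  reg : Reg A
  stk : Stacks A

def Conf.toCfg (x : Conf A) (s : Scratch A) :
    Turing.TM2.Cfg (Stack.Symbol A) Label (Reg A × Scratch A) :=
  ⟨some x.label, (x.reg, s), x.stk.get⟩

/-- From `x`, the machine reaches `y` in at most `n` steps. -/
def Reach (n : ℕ) (x y : Conf A) : Prop :=
  ∀ s, ∃ s', ∃ m ≤ n, (flip bind (Turing.TM2.step (prog inα inβ c)))^[m] (some (x.toCfg s)) =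
    some (y.toCfg s')

variable {inα inβ c}

theorem Reach.refl (x : Conf A) : Reach inα inβ c 0 x x := fun s => ⟨s, 0, le_rfl, rfl⟩

theorem Reach.mono {m n : ℕ} {x y : Conf A} (h : Reach inα inβ c m x y) (hmn : m ≤ n) :
    Reach inα inβ c n x y := fun s =>
  let ⟨s', k, hk, h⟩ := h s
  ⟨s', k, hk.trans hmn, h⟩

theorem Reach.trans {m n : ℕ} {x y z : Conf A} (h : Reach inα inβ c m x y)
    (h' : Reach inα inβ c n y z) : Reach inα inβ c (m + n) x z := by
  intro s
  obtain ⟨s', k, hk, h⟩ := h s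
  obtain ⟨s'', k', hk', h'⟩ := h' s'
  exact ⟨s'', k' + k, by omega, by rw [Function.iterate_add_apply, h, h']⟩

theorem Reach.of_step {x y : Conf A} (h : ∀ s, ∃ s',
    Turing.TM2.step (prog inα inβ c) (x.toCfg s) = some (y.toCfg s')) :
    Reach inα inβ c 1 x y := fun s =>
  let ⟨s', h⟩ := h s
  ⟨s', 1, le_rfl, h⟩

end

/-! ### Updates of single stacks -/

theorem Stacks.update_inp (s : Stacks A) (l : List (Tok A ⊕ Cert A)) :
    Function.update s.get .inp l = ({ s with inp := l } : Stacks A).get := by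
  funext k; cases k <;> rfl

theorem Stacks.update_rd (s : Stacks A) (l : List (Tok A)) :
    Function.update s.get .rd l = ({ s with rd := l } : Stacks A).get := by
  funext k; cases k <;> rfl

theorem Stacks.update_tab (s : Stacks A) (l : List (Val A)) :
    Function.update s.get .tab l = ({ s with tab := l } : Stacks A).get := by
  funext k; cases k <;> rfl

theorem Stacks.update_tab' (s : Stacks A) (l : List (Val A)) :
    Function.update s.get .tab' l = ({ s with tab' := l } : Stacks A).get := by
  funext k; cases k <;> rfl

theorem Stacks.update_asg (s : Stacks A) (l : List A) :
    Function.update s.get .asg l = ({ s with asg := l } : Stacks A).get := by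
  funext k; cases k <;> rfl

theorem Stacks.update_asg' (s : Stacks A) (l : List A) :
    Function.update s.get .asg' l = ({ s with asg' := l } : Stacks A).get := by
  funext k; cases k <;> rfl

theorem Stacks.update_bools (s : Stacks A) (l : List Bool) :
    Function.update s.get .bools l = ({ s with bools := l } : Stacks A).get := by
  funext k; cases k <;> rfl

theorem Stacks.update_clk (s : Stacks A) (l : List Unit) :
    Function.update s.get .clk l = ({ s with clk := l } : Stacks A).get := by
  funext k; cases k <;> rfl

theorem Stacks.update_out (s : Stacks A) (l : List Bool) :
    Function.update s.get .out l = ({ s with out := l } : Stacks A).get := by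
  funext k; cases k <;> rfl

/-! ### Single steps -/

section
variable [DecidableEq A] {inα inβ : A → Bool} {c : A}

theorem reach_load (r : Reg A) (s : Stacks A) :
    Reach inα inβ c 1 ⟨.load, r, s⟩ ⟨if s.inp.head?.isSome then .load else .rewind, r, { s with
      inp := s.inp.tail
      rd := (tok? s.inp.head?).toList ++ s.rd
      tab := ((cert? s.inp.head?).bind Cert.entry?).toList ++ s.tab
      asg := ((cert? s.inp.head?).bind Cert.asg?).toList ++ s.asg
      clk := ((cert? s.inp.head?).bind Cert.tick?).toList ++ s.clk }⟩ := by
  refine .of_step fun sc => ?_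
  apply Exists.intro
  simp only [Conf.toCfg, Turing.TM2.step, prog, popInp, stepAux, stepAux_pushOpt, goto,
    Stacks.update_inp, Stacks.update_rd,
    Stacks.update_tab, Stacks.update_asg, Stacks.update_clk]
  rfl

theorem reach_rewind (r : Reg A) (s : Stacks A) :
    Reach inα inβ c 1 ⟨.rewind, r, s⟩ ⟨if s.rd.head?.isSome then .rewind else .clock, r, { s with
      rd := s.rd.tail
      inp := (s.rd.head?.map .inl).toList ++ s.inp }⟩ := by
  refine .of_step fun sc => ?_
  apply Exists.intro
  simp only [Conf.toCfg, Turing.TM2.step, prog, popRd, stepAux, stepAux_pushOpt, goto, Option.isSome_map,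
    Stacks.update_inp, Stacks.update_rd]
  rfl

theorem reach_clock (r : Reg A) (s : Stacks A) :
    Reach inα inβ c 1 ⟨.clock, r, s⟩ ⟨if s.clk.head?.isSome then .quants else .clean, r, { s with
      clk := s.clk.tail }⟩ := by
  refine .of_step fun sc => ?_
  apply Exists.intro
  simp only [Conf.toCfg, Turing.TM2.step, prog, popClk, stepAux, goto,
    Stacks.update_clk]
  rfl

theorem reach_quants (r : Reg A) (s : Stacks A) :
    Reach inα inβ c 1 ⟨.quants, r, s⟩ ⟨if (quant? s.inp.head?).isSome then .quants else .back .quants, quantReg r (quant? s.inp.head?) s.tab.head?, { s with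
      inp := (if (quant? s.inp.head?).isSome then none else s.inp.head?).toList ++ s.inp.tail
      rd := (if (quant? s.inp.head?).isSome then tok? s.inp.head? else none).toList ++ s.rd
      tab := (if (quant? s.inp.head?).isSome then none else s.tab.head?).toList ++ s.tab.tail
      tab' := ((quant? s.inp.head?).bind fun q => s.tab.head?.map (quantEntry r.first q)).toList ++ s.tab' }⟩ := by
  refine .of_step fun sc => ?_
  apply Exists.intro
  simp only [Conf.toCfg, Turing.TM2.step, prog, popInp, popTab, setReg, stepAux, stepAux_pushOpt, goto,
    Stacks.update_inp, Stacks.update_rd, Stacks.update_tab, Stacks.update_tab']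
  rfl

theorem reach_back (p : Place) (r : Reg A) (s : Stacks A) :
    Reach inα inβ c 1 ⟨.back p, r, s⟩ ⟨if s.tab'.head?.isSome then .back p else p.next, if s.tab'.head?.isSome then r else r.leave inα inβ p, { s with
      tab' := s.tab'.tail
      tab := s.tab'.head?.toList ++ s.tab }⟩ := by
  refine .of_step fun sc => ?_
  apply Exists.intro
  simp only [Conf.toCfg, Turing.TM2.step, prog, popTab', setReg, stepAux, stepAux_pushOpt, goto,
    Stacks.update_tab, Stacks.update_tab']
  rfl

theorem reach_atoms (r : Reg A) (s : Stacks A) :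
    Reach inα inβ c 1 ⟨.atoms, r, s⟩ ⟨match tok? s.inp.head? with
      | none => .rewind
      | some .eq => .term .eq₁
      | _ => .args, r, { s with
      inp := s.inp.tail
      rd := (tok? s.inp.head?).toList ++ s.rd }⟩ := by
  refine .of_step fun sc => ?_
  apply Exists.intro
  simp only [Conf.toCfg, Turing.TM2.step, prog, popInp, stepAux, stepAux_pushOpt, goto,
    Stacks.update_inp, Stacks.update_rd]
  rfl

theorem reach_term (p : Place) (r : Reg A) (s : Stacks A) :
    Reach inα inβ c 1 ⟨.term p, r, s⟩ ⟨(match tok? s.inp.head? with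
        | some .tick => .term p
        | _ => .back p), (match tok? s.inp.head? with
        | some .tick => r
        | t => r.merge (termVal t s.tab.head?)), { s with
      inp := s.inp.tail
      rd := (tok? s.inp.head?).toList ++ s.rd
      tab := (match tok? s.inp.head? with
        | some .tick => none
        | some .var => s.tab.head?.map fun e => Option.or e r.w
        | _ => s.tab.head?).toList ++ s.tab.tail
      tab' := (match tok? s.inp.head? with
        | some .tick => s.tab.head?
        | _ => none).toList ++ s.tab' }⟩ := by
  refine .of_step fun sc => ?_
  apply Exists.intro
  simp only [Conf.toCfg, Turing.TM2.step, prog, popInp, popTab, setReg, stepAux, stepAux_pushOpt, goto,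
    Stacks.update_inp, Stacks.update_rd, Stacks.update_tab, Stacks.update_tab']
  rfl

theorem reach_unread (r : Reg A) (s : Stacks A) :
    Reach inα inβ c 1 ⟨.unread, r, s⟩ ⟨(match tok? (s.rd.head?.map Sum.inl) with
        | some .eq => .term .eq₃
        | _ => .unread), r, { s with
      rd := (match tok? (s.rd.head?.map Sum.inl) with
        | some .eq => some Tok.eq
        | _ => none).toList ++ s.rd.tail
      inp := (match tok? (s.rd.head?.map Sum.inl) with
        | some .eq => none
        | _ => s.rd.head?.map Sum.inl).toList ++ s.inp }⟩ := by
  refine .of_step fun sc => ?_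
  apply Exists.intro
  simp only [Conf.toCfg, Turing.TM2.step, prog, popRd, stepAux, stepAux_pushOpt, goto,
    Stacks.update_inp, Stacks.update_rd]
  rfl

theorem reach_args (r : Reg A) (s : Stacks A) :
    Reach inα inβ c 1 ⟨.args, r, s⟩ ⟨(match tok? s.inp.head? with
        | some .colon => .restore
        | _ => .term .arg), (match tok? s.inp.head? with
        | some .colon => r
        | _ => { r with asgd := r.asgd.next inα inβ (some (s.asg.head?.getD c)) }), { s with
      inp := (match tok? s.inp.head? with
        | some .colon => none
        | _ => s.inp.head?).toList ++ s.inp.tail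
      rd := (match tok? s.inp.head? with
        | some .colon => some Tok.colon
        | _ => none).toList ++ s.rd
      asg := (match tok? s.inp.head? with
        | some .colon => s.asg.head?
        | _ => none).toList ++ s.asg.tail
      asg' := (match tok? s.inp.head? with
        | some .colon => none
        | _ => s.asg.head?).toList ++ s.asg' }⟩ := by
  refine .of_step fun sc => ?_
  apply Exists.intro
  simp only [Conf.toCfg, Turing.TM2.step, prog, popInp, popAsg, setReg, stepAux, stepAux_pushOpt, goto,
    Stacks.update_inp, Stacks.update_rd, Stacks.update_asg, Stacks.update_asg']
  rfl

theorem reach_restore (r : Reg A) (s : Stacks A) :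
    Reach inα inβ c 1 ⟨.restore, r, s⟩ ⟨if s.asg'.head?.isSome then .restore else .form, r, { s with
      asg' := s.asg'.tail
      asg := s.asg'.head?.toList ++ s.asg }⟩ := by
  refine .of_step fun sc => ?_
  apply Exists.intro
  simp only [Conf.toCfg, Turing.TM2.step, prog, popAsg', stepAux, stepAux_pushOpt, goto,
    Stacks.update_asg, Stacks.update_asg']
  rfl

theorem reach_form (r : Reg A) (s : Stacks A) :
    Reach inα inβ c 1 ⟨.form, r, s⟩ ⟨(match tok? s.inp.head? with
        | some .var => .restore
        | some .close => .atoms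
        | _ => .form), formReg c r (tok? s.inp.head?) s.asg.head? s.bools.head?, { s with
      inp := s.inp.tail
      rd := (tok? s.inp.head?).toList ++ s.rd
      asg := (match tok? s.inp.head? with
        | some .tick => none
        | _ => s.asg.head?).toList ++ s.asg.tail
      asg' := (match tok? s.inp.head? with
        | some .tick => s.asg.head?
        | _ => none).toList ++ s.asg'
      bools := (formBools r (tok? s.inp.head?) s.bools.head? s.bools.tail.head?)[0]?.toList ++ ((formBools r (tok? s.inp.head?) s.bools.head? s.bools.tail.head?)[1]?.toList ++
        ((formBools r (tok? s.inp.head?) s.bools.head? s.bools.tail.head?)[2]?.toList ++ s.bools.tail.tail)) }⟩ := by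
  refine .of_step fun sc => ?_
  apply Exists.intro
  simp only [Conf.toCfg, Turing.TM2.step, prog, popInp, popAsg, popBools, setReg, stepAux, stepAux_pushOpt, goto,
    Stacks.update_inp, Stacks.update_rd,
    Stacks.update_asg, Stacks.update_asg', Stacks.update_bools]
  rfl

theorem reach_clean (r : Reg A) (s : Stacks A)
    (h : (s.inp.head?.isSome || s.tab.head?.isSome || s.asg.head?.isSome) = true) :
    Reach inα inβ c 1 ⟨.clean, r, s⟩ ⟨.clean, r, { s with
      inp := s.inp.tail
      tab := s.tab.tail
      asg := s.asg.tail }⟩ := by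
  refine .of_step fun sc => ?_
  apply Exists.intro
  simp only [Conf.toCfg, Turing.TM2.step, prog, popInp, popTab, popAsg, stepAux, goto,
    Stacks.update_inp, Stacks.update_tab, Stacks.update_asg]
  change some (bif s.inp.head?.isSome || s.tab.head?.isSome || s.asg.head?.isSome then _ else _) = _
  rw [h]
  rfl

end

/-! ### Loops -/

section
variable [DecidableEq A] {inα inβ : A → Bool} {c : A}

theorem reach_back_loop (p : Place) (r : Reg A) (s : Stacks A) (T U : List (Val A)) :
    Reach inα inβ c (U.length + 1) ⟨.back p, r, { s with tab := T, tab' := U }⟩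
      ⟨p.next, r.leave inα inβ p, { s with tab := U.reverse ++ T, tab' := [] }⟩ := by
  induction U generalizing T with
  | nil => exact reach_back p r _
  | cons e U ih =>
    have h := (reach_back p r { s with tab := T, tab' := e :: U }).trans (ih (e :: T))
    rw [List.reverse_cons, List.append_assoc]
    exact h.mono (by simp; omega)

/-- Each tick shifts one entry, so the entry sought ends on top of `tab`. A table that is too short
just runs empty, which later reads as an unknown value. -/
theorem reach_term_ticks (p : Place) (r : Reg A) (s : Stacks A) (i : ℕ)
    (I : List (Tok A ⊕ Cert A)) (R : List (Tok A)) (T U : List (Val A)) :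
    Reach inα inβ c i
      ⟨.term p, r, { s with
        inp := List.replicate i (.inl .tick) ++ I, rd := R, tab := T, tab' := U }⟩
      ⟨.term p, r, { s with
        inp := I
        rd := List.replicate i .tick ++ R
        tab := T.drop i
        tab' := (T.take i).reverse ++ U }⟩ := by
  induction i generalizing R T U with
  | zero => exact .refl _
  | succ i ih =>
    have hr : List.replicate (i + 1) Tok.tick ++ R = List.replicate i Tok.tick ++ Tok.tick :: R := by
      simp [List.replicate_succ']
    rw [hr]
    have h := reach_term (inα := inα) (inβ := inβ) (c := c) p r { s with
      inp := List.replicate (i + 1) (.inl .tick) ++ I, rd := R, tab := T, tab' := U }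
    cases T with
    | nil =>
      have h' := h.trans (ih (.tick :: R) [] U)
      simp only [List.drop_nil, List.take_nil] at h' ⊢
      exact h'.mono (by omega)
    | cons e T =>
      have h' := h.trans (ih (.tick :: R) T (e :: U))
      rw [List.take_succ_cons, List.reverse_cons, List.append_assoc]
      exact h'.mono (by omega)

/-- Looking up a term, and merging its value with the current value. -/
theorem reach_term_run (p : Place) (r : Reg A) (s : Stacks A) {n : ℕ} (t : Term A n)
    (I : List (Tok A ⊕ Cert A)) (R : List (Tok A)) (T : List (Val A)) :
    Reach inα inβ c (2 * t.encode.length)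
      ⟨.term p, r, { s with inp := t.encode.map .inl ++ I, rd := R, tab := T, tab' := [] }⟩
      ⟨p.next, (r.merge (t.lookup T)).leave inα inβ p, { s with
        inp := I, rd := t.encode.reverse ++ R, tab := t.update T r.w, tab' := [] }⟩ := by
  cases t with
  | const a =>
    have h : Reach inα inβ c 1
        ⟨.term p, r, { s with inp := .inl (.const a) :: I, rd := R, tab := T, tab' := [] }⟩
        ⟨.back p, r.merge (some (some a)), { s with
          inp := I, rd := .const a :: R, tab := T, tab' := [] }⟩ := by
      cases T <;> exact reach_term p r _
    exact h.trans (reach_back_loop p (r.merge (some (some a)))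
      { s with inp := I, rd := .const a :: R } T [])
  | var i =>
    have h1 := reach_term_ticks (inα := inα) (inβ := inβ) (c := c) p r s i (.inl .var :: I) R T []
    have h2 := reach_term (inα := inα) (inβ := inβ) (c := c) p r { s with
      inp := .inl .var :: I, rd := List.replicate i .tick ++ R, tab := T.drop i,
      tab' := (T.take i).reverse ++ [] }
    have h3 := h1.trans (h2.trans (reach_back_loop p
      (r.merge (termVal (some .var) (T.drop i).head?))
      { s with inp := I, rd := .var :: (List.replicate i .tick ++ R) }
      (((T.drop i).head?.map fun e => Option.or e r.w).toList ++ (T.drop i).tail)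
      ((T.take i).reverse ++ [])))
    have e1 : ((Term.var i : Term A n).encode.map .inl ++ I : List (Tok A ⊕ Cert A)) =
        List.replicate i (.inl .tick) ++ .inl .var :: I := by
      simp [Term.encode]
    have e2 : (Term.var i : Term A n).encode.reverse ++ R =
        .var :: (List.replicate i .tick ++ R) := by
      simp [Term.encode]
    -- Modifying entry `i` means changing the top of what remains after the first `i` entries were
    -- shifted away.
    have e3 : (Term.var i : Term A n).update T r.w = ((T.take i).reverse ++ []).reverse ++
        (((T.drop i).head?.map fun e => Option.or e r.w).toList ++ (T.drop i).tail) := by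
      simp only [Term.update, List.modify_eq_take_drop, List.append_nil, List.reverse_reverse]
      cases T.drop i <;> rfl
    have e4 : (Term.var i : Term A n).lookup T = termVal (some .var) (T.drop i).head? := by
      simp [Term.lookup, termVal, List.getD_eq_getElem?_getD]
    rw [e1, e2, e3, e4]
    refine h3.mono ?_
    simp [Term.encode]
    omega

theorem reach_unread_loop (r : Reg A) (s : Stacks A) (I : List (Tok A ⊕ Cert A))
    (R l : List (Tok A)) (hl : ∀ t ∈ l, t ≠ .eq) :
    Reach inα inβ c (l.length + 1) ⟨.unread, r, { s with inp := I, rd := l ++ .eq :: R }⟩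
      ⟨.term .eq₃, r, { s with inp := (l.reverse.map .inl) ++ I, rd := .eq :: R }⟩ := by
  induction l generalizing I with
  | nil => exact reach_unread r _
  | cons t l ih =>
    have h := reach_unread (inα := inα) (inβ := inβ) (c := c) r { s with
      inp := I, rd := t :: l ++ .eq :: R }
    have h' := ih (.inl t :: I) fun t ht => hl t (by simp [ht])
    have ht := hl t (by simp)
    rw [List.reverse_cons, List.map_append, List.append_assoc]
    cases t <;> first | exact (ht rfl).elim | exact (h.trans h').mono (by simp; omega)

theorem reach_restore_loop (r : Reg A) (s : Stacks A) (X Y : List A) :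
    Reach inα inβ c (Y.length + 1) ⟨.restore, r, { s with asg := X, asg' := Y }⟩
      ⟨.form, r, { s with asg := Y.reverse ++ X, asg' := [] }⟩ := by
  induction Y generalizing X with
  | nil => exact reach_restore r _
  | cons x Y ih =>
    have h := (reach_restore (inα := inα) (inβ := inβ) (c := c) r
      { s with asg := X, asg' := x :: Y }).trans (ih (x :: X))
    rw [List.reverse_cons, List.append_assoc]
    exact h.mono (by simp; omega)

theorem reach_rewind_loop (r : Reg A) (s : Stacks A) (I : List (Tok A ⊕ Cert A))
    (R : List (Tok A)) :
    Reach inα inβ c (R.length + 1) ⟨.rewind, r, { s with inp := I, rd := R }⟩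
      ⟨.clock, r, { s with inp := R.reverse.map .inl ++ I, rd := [] }⟩ := by
  induction R generalizing I with
  | nil => exact reach_rewind r _
  | cons t R ih =>
    have h := (reach_rewind (inα := inα) (inβ := inβ) (c := c) r
      { s with inp := I, rd := t :: R }).trans (ih (.inl t :: I))
    rw [List.reverse_cons, List.map_append, List.append_assoc]
    exact h.mono (by simp; omega)

end

/-! ### The quantifier prefix -/

/-- The table after reading the quantifier prefix. -/
def resetIf (first : Bool) (qs : List Quant) (T : List (Val A)) : List (Val A) :=
  if first then reset qs T else T

theorem resetIf_nil (first : Bool) (qs : List Quant) : resetIf first qs ([] : List (Val A)) = [] := by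
  cases first
  · rfl
  · rcases qs with _ | ⟨_ | _, qs⟩ <;> rfl

theorem resetIf_cons (first : Bool) (q : Quant) (qs : List Quant) (e : Val A) (T : List (Val A)) :
    resetIf first (q :: qs) (e :: T) = quantEntry first q e :: resetIf first qs T := by
  cases first <;> cases q <;> rfl

theorem Term.update_none {n : ℕ} (T : List (Val A)) (t : Term A n) : t.update T none = T := by
  cases t with
  | const a => rfl
  | var i =>
    have : (fun e : Val A => e.or none) = id := funext fun e => Option.or_none
    simp only [Term.update, this, List.modify_id]

theorem Term.exists_encode {n : ℕ} (t : Term A n) :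
    ∃ x l, t.encode = x :: l ∧ (x = .tick ∨ x = .var ∨ ∃ a, x = .const a) := by
  cases t with
  | const a => exact ⟨_, _, rfl, by simp⟩
  | var i =>
    rcases i with ⟨_ | i, hi⟩
    · exact ⟨_, _, rfl, by simp⟩
    · exact ⟨.tick, _, rfl, by simp⟩

section
variable [DecidableEq A] {inα inβ : A → Bool} {c : A}

/-- The table may be shorter or longer than the prefix, so only the concatenation of the two table
stacks is described. The final `star` is left unspecified, as it is cleared next. -/
theorem reach_quants_loop (s : Stacks A) (qs : List Quant) (r : Reg A)
    (I : List (Tok A ⊕ Cert A)) (R : List (Tok A)) (T U : List (Val A)) :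
    ∃ T' U' b, Reach inα inβ c qs.length
        ⟨.quants, r, { s with
          inp := (qs.map Quant.encode).map .inl ++ I, rd := R, tab := T, tab' := U }⟩
        ⟨.quants, { r with
            star := b, acc := r.acc || (!r.star && openEx qs (resetIf r.first qs T)) }, { s with
          inp := I, rd := (qs.map Quant.encode).reverse ++ R, tab := T', tab' := U' }⟩ ∧
      U'.reverse ++ T' = U.reverse ++ resetIf r.first qs T ∧ U'.length ≤ U.length + qs.length := by
  induction qs generalizing r R T U with
  | nil =>
    refine ⟨T, U, r.star, ?_, by cases r.first <;> simp [resetIf, reset], by simp⟩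
    simp only [openEx, Bool.and_false, Bool.or_false]
    exact .refl _
  | cons q qs ih =>
    have hq : ((q :: qs).map (Quant.encode (A := A))).reverse ++ R =
        (qs.map Quant.encode).reverse ++ q.encode :: R := by simp
    cases T with
    | nil =>
      obtain ⟨T', U', b, h, h1, h2⟩ := ih r (q.encode :: R) [] U
      refine ⟨T', U', b, ?_, ?_, by simp; omega⟩
      · have hstep : Reach inα inβ c 1
            ⟨.quants, r, { s with
              inp := .inl q.encode :: ((qs.map Quant.encode).map .inl ++ I)
              rd := R, tab := [], tab' := U }⟩
            ⟨.quants, quantReg r (some q) none, { s with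
              inp := (qs.map Quant.encode).map .inl ++ I
              rd := q.encode :: R, tab := [], tab' := U }⟩ := by
          cases q <;> exact reach_quants r _
        have hr : quantReg r (some q) none = r := by simp [quantReg, isStar]
        rw [hr] at hstep
        have h := hstep.trans h
        rw [resetIf_nil] at h ⊢
        have ho : ∀ qs : List Quant, openEx qs ([] : List (Val A)) = false := fun qs => by
          cases qs <;> rfl
        rw [ho] at h ⊢
        rw [hq]
        exact h.mono (by simp; omega)
      · rw [h1, resetIf_nil, resetIf_nil]
    | cons e T =>
      obtain ⟨T', U', b, h, h1, h2⟩ := ih (quantReg r (some q) (some e)) (q.encode :: R) T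
        (quantEntry r.first q e :: U)
      have hf : (quantReg r (some q) (some e)).first = r.first := rfl
      rw [hf] at h h1
      refine ⟨T', U', b, ?_, ?_, by simp at h2 ⊢; omega⟩
      · have hstep : Reach inα inβ c 1
            ⟨.quants, r, { s with
              inp := .inl q.encode :: ((qs.map Quant.encode).map .inl ++ I)
              rd := R, tab := e :: T, tab' := U }⟩
            ⟨.quants, quantReg r (some q) (some e), { s with
              inp := (qs.map Quant.encode).map .inl ++ I
              rd := q.encode :: R, tab := T, tab' := quantEntry r.first q e :: U }⟩ := by
          cases q <;> exact reach_quants r _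
        have h := hstep.trans h
        have ho : ((quantReg r (some q) (some e)).acc ||
            (!(quantReg r (some q) (some e)).star && openEx qs (resetIf r.first qs T))) =
            (r.acc || (!r.star && openEx (q :: qs) (resetIf r.first (q :: qs) (e :: T)))) := by
          rw [resetIf_cons]
          simp only [quantReg, Option.map_some]
          generalize quantEntry r.first q e = e'
          rcases e' with _ | _ | a <;> cases q <;> cases r.acc <;> cases r.star <;>
            simp [isStar, openEx, Quant.isEx]
        rw [ho] at h
        rw [hq]
        exact h.mono (by simp; omega)
      · rw [h1, resetIf_cons]
        simp

theorem reach_quants_run (s : Stacks A) (qs : List Quant) (r : Reg A) (hr : r.star = false)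
    (I : List (Tok A ⊕ Cert A)) (hI : quant? I.head? = none) (R : List (Tok A))
    (T : List (Val A)) :
    Reach inα inβ c (2 * qs.length + 2)
      ⟨.quants, r, { s with
        inp := (qs.map Quant.encode).map .inl ++ I, rd := R, tab := T, tab' := [] }⟩
      ⟨.atoms, { r with
          first := false, star := false, acc := r.acc || openEx qs (resetIf r.first qs T) },
        { s with inp := I, rd := (qs.map Quant.encode).reverse ++ R
                 tab := resetIf r.first qs T, tab' := [] }⟩ := by
  obtain ⟨T', U', b, h, h1, h2⟩ := reach_quants_loop (inα := inα) (inβ := inβ) (c := c) s qs r I R T []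
  rw [hr] at h
  simp only [Bool.not_false, Bool.true_and] at h
  have hstep : ∀ r : Reg A, Reach inα inβ c 1
      ⟨.quants, r, { s with
        inp := I, rd := (qs.map Quant.encode).reverse ++ R, tab := T', tab' := U' }⟩
      ⟨.back .quants, { r with first := false, star := false }, { s with
        inp := I, rd := (qs.map Quant.encode).reverse ++ R, tab := T', tab' := U' }⟩ := by
    intro r
    have := reach_quants (inα := inα) (inβ := inβ) (c := c) r { s with
      inp := I, rd := (qs.map Quant.encode).reverse ++ R, tab := T', tab' := U' }
    simp only [hI] at this
    have hI' : I.head?.toList ++ I.tail = I := by cases I <;> rfl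
    have hT' : T'.head?.toList ++ T'.tail = T' := by cases T' <;> rfl
    simp only [Option.isSome_none, Bool.false_eq_true, if_false, hI', hT'] at this
    exact this
  have h3 := (h.trans (hstep _)).trans (reach_back_loop .quants _ { s with
    inp := I, rd := (qs.map Quant.encode).reverse ++ R } T' U')
  rw [h1] at h3
  exact h3.mono (by simp at h2; omega)

/-! ### The arguments of a relation -/

/-- Since the current value is `none` before each argument, a lookup does not change the table. Both
trackers advance by one value per argument; an exhausted tuple supplies `c`. -/
theorem reach_args_loop (s : Stacks A) {n : ℕ} (l : List (Term A n)) (r : Reg A)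
    (hr : r.w = none) (I : List (Tok A ⊕ Cert A)) (R : List (Tok A)) (T : List (Val A))
    (X Y : List A) :
    Reach inα inβ c (3 * (l.flatMap Term.encode).length)
      ⟨.args, r, { s with
        inp := (l.flatMap Term.encode).map .inl ++ I, rd := R
        tab := T, tab' := [], asg := X, asg' := Y }⟩
      ⟨.args, { r with
          known := (l.map fun t => (t.lookup T).join).foldl (Tracker.next inα inβ) r.known
          asgd := ((List.range l.length).map fun j => some (X.getD j c)).foldl
            (Tracker.next inα inβ) r.asgd },
        { s with
          inp := I, rd := (l.flatMap Term.encode).reverse ++ R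
          tab := T, tab' := [], asg := X.drop l.length
          asg' := (X.take l.length).reverse ++ Y }⟩ := by
  induction l generalizing r R X Y with
  | nil => exact .refl _
  | cons t l ih =>
    obtain ⟨x, l', hx, hx'⟩ := t.exists_encode
    let r' : Reg A := { r with asgd := r.asgd.next inα inβ (some (X.head?.getD c)) }
    have h1 : Reach inα inβ c 1
        ⟨.args, r, { s with
          inp := t.encode.map .inl ++ ((l.flatMap Term.encode).map .inl ++ I), rd := R
          tab := T, tab' := [], asg := X, asg' := Y }⟩
        ⟨.term .arg, r', { s with
          inp := t.encode.map .inl ++ ((l.flatMap Term.encode).map .inl ++ I), rd := R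
          tab := T, tab' := [], asg := X.tail, asg' := X.head?.toList ++ Y }⟩ := by
      rw [hx]
      rcases hx' with rfl | rfl | ⟨a, rfl⟩ <;> exact reach_args r _
    have h2 := reach_term_run (inα := inα) (inβ := inβ) (c := c) .arg r'
      { s with asg := X.tail, asg' := X.head?.toList ++ Y } t
      ((l.flatMap Term.encode).map .inl ++ I) R T
    have hw : r'.w = none := hr
    have hr' : (r'.merge (t.lookup T)).leave inα inβ .arg =
        { r' with known := r.known.next inα inβ (t.lookup T).join } := by
      have hcl : clash (t.lookup T) none = false := by
        unfold clash; split <;> simp_all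
      simp [Reg.merge, Reg.leave, hcl, r', hr]
    rw [hw, Term.update_none, hr'] at h2
    have h3 := ih { r' with known := r.known.next inα inβ (t.lookup T).join } hr
      (t.encode.reverse ++ R) X.tail (X.head?.toList ++ Y)
    have h := (h1.trans h2).trans h3
    have e1 : (((t :: l).flatMap Term.encode).map .inl ++ I : List (Tok A ⊕ Cert A)) =
        t.encode.map .inl ++ ((l.flatMap Term.encode).map .inl ++ I) := by simp
    have e2 : ((t :: l).flatMap Term.encode).reverse ++ R =
        (l.flatMap Term.encode).reverse ++ (t.encode.reverse ++ R) := by simp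
    have e3 : X.drop (t :: l).length = X.tail.drop l.length := by simp
    have e4 : (X.take (t :: l).length).reverse ++ Y =
        (X.tail.take l.length).reverse ++ (X.head?.toList ++ Y) := by
      cases X <;> simp
    have e5 : ((List.range (t :: l).length).map fun j => some (X.getD j c)) =
        some (X.head?.getD c) :: ((List.range l.length).map fun j => some (X.tail.getD j c)) := by
      rw [List.length_cons, List.range_succ_eq_map]
      simp [List.head?_eq_getElem?, Function.comp_def]
    rw [e1, e2, e3, e4, e5]
    refine h.mono ?_
    have := t.length_encode_pos
    simp only [List.flatMap_cons, List.length_append]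
    omega

/-! ### Evaluation of formulas -/

theorem reach_form_ticks (r : Reg A) (s : Stacks A) (i : ℕ)
    (I : List (Tok A ⊕ Cert A)) (R : List (Tok A)) (X Y : List A) :
    Reach inα inβ c i
      ⟨.form, r, { s with
        inp := List.replicate i (.inl .tick) ++ I, rd := R, asg := X, asg' := Y }⟩
      ⟨.form, r, { s with
        inp := I
        rd := List.replicate i .tick ++ R
        asg := X.drop i
        asg' := (X.take i).reverse ++ Y }⟩ := by
  induction i generalizing R X Y with
  | zero => exact .refl _
  | succ i ih =>
    have hr : List.replicate (i + 1) Tok.tick ++ R = List.replicate i Tok.tick ++ Tok.tick :: R := by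
      simp [List.replicate_succ']
    rw [hr]
    have h : Reach inα inβ c 1
        ⟨.form, r, { s with
          inp := List.replicate (i + 1) (.inl .tick) ++ I, rd := R, asg := X, asg' := Y }⟩
        ⟨.form, r, { s with
          inp := List.replicate i (.inl .tick) ++ I, rd := .tick :: R
          asg := X.tail, asg' := X.head?.toList ++ Y }⟩ := by
      -- Every step pops up to two truth values and pushes them back, so it computes only once the
      -- top of `bools` is known.
      rcases s with ⟨_, _, _, _, _, _, _ | ⟨b, _ | ⟨b', B⟩⟩, _, _⟩ <;> exact reach_form r _
    cases X with
    | nil =>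
      have h' := h.trans (ih (.tick :: R) [] Y)
      simp only [List.drop_nil, List.take_nil] at h' ⊢
      exact h'.mono (by omega)
    | cons e X =>
      have h' := h.trans (ih (.tick :: R) X (e :: Y))
      rw [List.take_succ_cons, List.reverse_cons, List.append_assoc]
      exact h'.mono (by omega)

theorem reach_form_term (r : Reg A) (s : Stacks A) {k : ℕ} (t : Term A k)
    (I : List (Tok A ⊕ Cert A)) (R : List (Tok A)) (X : List A) :
    Reach inα inβ c (2 * t.encode.length)
      ⟨.form, r, { s with inp := t.encode.map .inl ++ I, rd := R, asg := X, asg' := [] }⟩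
      ⟨.form, { r with v₂ := r.v₁, v₁ := t.eval fun j => X.getD j c }, { s with
        inp := I, rd := t.encode.reverse ++ R, asg := X, asg' := [] }⟩ := by
  cases t with
  | const a =>
    have h : Reach inα inβ c 1
        ⟨.form, r, { s with inp := .inl (.const a) :: I, rd := R, asg := X, asg' := [] }⟩
        ⟨.form, { r with v₂ := r.v₁, v₁ := a }, { s with
          inp := I, rd := .const a :: R, asg := X, asg' := [] }⟩ := by
      rcases s with ⟨_, _, _, _, _, _, _ | ⟨b, _ | ⟨b', B⟩⟩, _, _⟩ <;> cases X <;>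
        exact reach_form r _
    exact h.mono (by simp [Term.encode])
  | var i =>
    have h1 := reach_form_ticks (inα := inα) (inβ := inβ) (c := c) r s i (.inl .var :: I) R X []
    have h2 : Reach inα inβ c 1
        ⟨.form, r, { s with
          inp := .inl .var :: I, rd := List.replicate i .tick ++ R
          asg := X.drop i, asg' := (X.take i).reverse ++ [] }⟩
        ⟨.restore, { r with v₂ := r.v₁, v₁ := (X.drop i).head?.getD c }, { s with
          inp := I, rd := .var :: (List.replicate i .tick ++ R)
          asg := X.drop i, asg' := (X.take i).reverse ++ [] }⟩ := by
      rcases s with ⟨_, _, _, _, _, _, _ | ⟨b, _ | ⟨b', B⟩⟩, _, _⟩ <;> cases X.drop i <;>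
        exact reach_form r _
    have h3 := (h1.trans h2).trans (reach_restore_loop _
      { s with inp := I, rd := .var :: (List.replicate i .tick ++ R) } (X.drop i)
      ((X.take i).reverse ++ []))
    have e1 : ((Term.var i : Term A k).encode.map .inl ++ I : List (Tok A ⊕ Cert A)) =
        List.replicate i (.inl .tick) ++ .inl .var :: I := by
      simp [Term.encode]
    have e2 : (Term.var i : Term A k).encode.reverse ++ R =
        .var :: (List.replicate i .tick ++ R) := by
      simp [Term.encode]
    have e3 : ((X.take i).reverse ++ []).reverse ++ X.drop i = X := by simp
    have e4 : (X.drop i).head?.getD c = (Term.var i : Term A k).eval fun j => X.getD j c := by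
      simp [Term.eval, List.getD_eq_getElem?_getD]
    rw [e3, e4] at h3
    rw [e1, e2]
    refine h3.mono ?_
    simp [Term.encode]
    omega

/-- Postfix evaluation: a subformula puts exactly one truth value on top of an arbitrary stack `B`,
where the connective that follows finds it. -/
theorem reach_form_run (s : Stacks A) {k : ℕ} (f : QF A k) (r : Reg A) (hr₁ : r.v₁ = c)
    (hr₂ : r.v₂ = c) (I : List (Tok A ⊕ Cert A)) (R : List (Tok A)) (X : List A) (B : List Bool) :
    Reach inα inβ c (2 * f.encode.length)
      ⟨.form, r, { s with
        inp := f.encode.map .inl ++ I, rd := R, asg := X, asg' := [], bools := B }⟩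
      ⟨.form, r, { s with
        inp := I, rd := f.encode.reverse ++ R, asg := X, asg' := []
        bools := f.val (fun j => X.getD j c) :: B }⟩ := by
  induction f generalizing I R B with
  | eq t u =>
    have h1 := reach_form_term (inα := inα) (inβ := inβ) (c := c) r { s with bools := B } t
      (u.encode.map .inl ++ .inl .eq :: I) R X
    have h2 := reach_form_term (inα := inα) (inβ := inβ) (c := c)
      { r with v₂ := r.v₁, v₁ := t.eval fun j => X.getD j c } { s with bools := B } u
      (.inl .eq :: I) (t.encode.reverse ++ R) X
    have h3 : Reach inα inβ c 1
        ⟨.form, { r with v₂ := t.eval fun j => X.getD j c, v₁ := u.eval fun j => X.getD j c },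
          { s with
            inp := .inl .eq :: I, rd := u.encode.reverse ++ (t.encode.reverse ++ R)
            asg := X, asg' := [], bools := B }⟩
        ⟨.form, { r with v₂ := c, v₁ := c }, { s with
            inp := I, rd := .eq :: (u.encode.reverse ++ (t.encode.reverse ++ R))
            asg := X, asg' := []
            bools := (QF.eq t u).val (fun j => X.getD j c) :: B }⟩ := by
      rcases B with _ | ⟨b, _ | ⟨b', B⟩⟩ <;> cases X <;> exact reach_form _ _
    have hrr : { r with v₂ := c, v₁ := c } = r := by
      cases r; simp_all
    rw [hrr] at h3
    have h := (h1.trans h2).trans h3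
    have e1 : ((QF.eq t u).encode.map .inl ++ I : List (Tok A ⊕ Cert A)) =
        t.encode.map .inl ++ (u.encode.map .inl ++ .inl .eq :: I) := by simp [QF.encode]
    have e2 : (QF.eq t u).encode.reverse ++ R =
        .eq :: (u.encode.reverse ++ (t.encode.reverse ++ R)) := by simp [QF.encode]
    rw [e1, e2]
    refine h.mono ?_
    simp only [QF.encode, List.length_append, List.length_singleton]
    omega
  | neg f ih =>
    have h1 := ih (.inl .neg :: I) R B
    have h2 : Reach inα inβ c 1
        ⟨.form, r, { s with
            inp := .inl .neg :: I, rd := f.encode.reverse ++ R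
            asg := X, asg' := [], bools := f.val (fun j => X.getD j c) :: B }⟩
        ⟨.form, r, { s with
            inp := I, rd := .neg :: (f.encode.reverse ++ R)
            asg := X, asg' := []
            bools := (QF.neg f).val (fun j => X.getD j c) :: B }⟩ := by
      rcases B with _ | ⟨b, B⟩ <;> cases X <;> exact reach_form _ _
    have e1 : ((QF.neg f).encode.map .inl ++ I : List (Tok A ⊕ Cert A)) =
        f.encode.map .inl ++ .inl .neg :: I := by simp [QF.encode]
    have e2 : (QF.neg f).encode.reverse ++ R = .neg :: (f.encode.reverse ++ R) := by
      simp [QF.encode]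
    rw [e1, e2]
    refine (h1.trans h2).mono ?_
    simp only [QF.encode, List.length_append, List.length_singleton]
    omega
  | and f g ihf ihg =>
    have h1 := ihf (g.encode.map .inl ++ .inl .and :: I) R B
    have h2 := ihg (.inl .and :: I) (f.encode.reverse ++ R) (f.val (fun j => X.getD j c) :: B)
    have h3 : Reach inα inβ c 1
        ⟨.form, r, { s with
            inp := .inl .and :: I, rd := g.encode.reverse ++ (f.encode.reverse ++ R)
            asg := X, asg' := []
            bools := g.val (fun j => X.getD j c) :: f.val (fun j => X.getD j c) :: B }⟩
        ⟨.form, r, { s with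
            inp := I, rd := .and :: (g.encode.reverse ++ (f.encode.reverse ++ R))
            asg := X, asg' := []
            bools := (QF.and f g).val (fun j => X.getD j c) :: B }⟩ := by
      cases X <;> exact reach_form _ _
    have e1 : ((QF.and f g).encode.map .inl ++ I : List (Tok A ⊕ Cert A)) =
        f.encode.map .inl ++ (g.encode.map .inl ++ .inl .and :: I) := by simp [QF.encode]
    have e2 : (QF.and f g).encode.reverse ++ R =
        .and :: (g.encode.reverse ++ (f.encode.reverse ++ R)) := by simp [QF.encode]
    rw [e1, e2]
    refine ((h1.trans h2).trans h3).mono ?_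
    simp only [QF.encode, List.length_append, List.length_singleton]
    omega
  | or f g ihf ihg =>
    have h1 := ihf (g.encode.map .inl ++ .inl .or :: I) R B
    have h2 := ihg (.inl .or :: I) (f.encode.reverse ++ R) (f.val (fun j => X.getD j c) :: B)
    have h3 : Reach inα inβ c 1
        ⟨.form, r, { s with
            inp := .inl .or :: I, rd := g.encode.reverse ++ (f.encode.reverse ++ R)
            asg := X, asg' := []
            bools := g.val (fun j => X.getD j c) :: f.val (fun j => X.getD j c) :: B }⟩
        ⟨.form, r, { s with
            inp := I, rd := .or :: (g.encode.reverse ++ (f.encode.reverse ++ R))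
            asg := X, asg' := []
            bools := (QF.or f g).val (fun j => X.getD j c) :: B }⟩ := by
      cases X <;> exact reach_form _ _
    have e1 : ((QF.or f g).encode.map .inl ++ I : List (Tok A ⊕ Cert A)) =
        f.encode.map .inl ++ (g.encode.map .inl ++ .inl .or :: I) := by simp [QF.encode]
    have e2 : (QF.or f g).encode.reverse ++ R =
        .or :: (g.encode.reverse ++ (f.encode.reverse ++ R)) := by simp [QF.encode]
    rw [e1, e2]
    refine ((h1.trans h2).trans h3).mono ?_
    simp only [QF.encode, List.length_append, List.length_singleton]
    omega

end

/-! ### Atoms and rounds -/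

/-- The stacks between two atoms. -/
def Stacks.mk' (I : List (Tok A ⊕ Cert A)) (R : List (Tok A)) (T : List (Val A)) (X : List A)
    (K : List Unit) : Stacks A :=
  ⟨I, R, T, [], X, [], [], K, []⟩

theorem length_reset (qs : List Quant) (T : List (Val A)) : (reset qs T).length = T.length := by
  induction qs generalizing T with
  | nil => simp [reset]
  | cons q qs ih => cases T <;> cases q <;> simp [reset, ih]

theorem quant?_flatMap_encode {n : ℕ} (l : List (Atom A n)) :
    quant? ((l.flatMap Atom.encode).map .inl : List (Tok A ⊕ Cert A)).head? = none := by
  cases l with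
  | nil => rfl
  | cons a l => cases a <;> rfl

theorem Term.ne_eq_of_mem_encode {n : ℕ} {t : Term A n} {x : Tok A} (h : x ∈ t.encode) :
    x ≠ .eq := by
  rintro rfl
  cases t <;> simp [Term.encode] at h

section
variable [DecidableEq A] {inα inβ : A → Bool} {c : A}

/-- The registers during the processing of an equality. -/
def Reg.eq (c : A) (m : List (Val A) × Val A × Bool) : Reg A :=
  ⟨m.2.1, c, c, .init, .init, false, false, m.2.2⟩

theorem reach_merge (p : Place) (hp : p = .eq₁ ∨ p = .eq₂ ∨ p = .eq₃) {n : ℕ} (t : Term A n)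
    (m : List (Val A) × Val A × Bool) (I : List (Tok A ⊕ Cert A)) (R : List (Tok A)) (X : List A)
    (K : List Unit) :
    Reach inα inβ c (2 * t.encode.length)
      ⟨.term p, .eq c m, .mk' (t.encode.map .inl ++ I) R m.1 X K⟩
      ⟨p.next, .eq c (merge m t), .mk' I (t.encode.reverse ++ R) (merge m t).1 X K⟩ := by
  rcases hp with rfl | rfl | rfl <;> exact reach_term_run _ (.eq c m) (.mk' I R m.1 X K) t I R m.1

theorem reach_merge_last {n : ℕ} (t : Term A n)
    (m : List (Val A) × Val A × Bool) (I : List (Tok A ⊕ Cert A)) (R : List (Tok A)) (X : List A)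
    (K : List Unit) :
    Reach inα inβ c (2 * t.encode.length)
      ⟨.term .eq₄, .eq c m, .mk' (t.encode.map .inl ++ I) R m.1 X K⟩
      ⟨.atoms, .base c (merge m t).2.2, .mk' I (t.encode.reverse ++ R) (merge m t).1 X K⟩ :=
  reach_term_run _ (.eq c m) (.mk' I R m.1 X K) t I R m.1

theorem reach_eq {n : ℕ} (t u : Term A n) (acc : Bool) (I : List (Tok A ⊕ Cert A))
    (R : List (Tok A)) (T : List (Val A)) (X : List A) (K : List Unit) :
    Reach inα inβ c (6 * (Atom.eq t u).encode.length)
      ⟨.atoms, .base c acc, .mk' ((Atom.eq t u).encode.map .inl ++ I) R T X K⟩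
      ⟨.atoms, .base c (acc || (Atom.eq t u).refutes inα inβ c X T),
        .mk' I ((Atom.eq t u).encode.reverse ++ R) ((Atom.eq t u).table T) X K⟩ := by
  have h0 : Reach inα inβ c 1
      ⟨.atoms, .base c acc,
        .mk' (.inl .eq :: (t.encode.map .inl ++ (u.encode.map .inl ++ I))) R T X K⟩
      ⟨.term .eq₁, .eq c (T, none, acc),
        .mk' (t.encode.map .inl ++ (u.encode.map .inl ++ I)) (.eq :: R) T X K⟩ :=
    reach_atoms _ _
  set m := merge (merge (T, none, acc) t) u with hm
  have h1 := h0.trans (reach_merge .eq₁ (by simp) t (T, none, acc) (u.encode.map .inl ++ I)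
    (.eq :: R) X K)
  have h2 := h1.trans (reach_merge .eq₂ (by simp) u (merge (T, none, acc) t) I
    (t.encode.reverse ++ .eq :: R) X K)
  have h3 := reach_unread_loop (inα := inα) (inβ := inβ) (c := c) (.eq c m) (.mk' I R m.1 X K) I R
    (u.encode.reverse ++ t.encode.reverse) (by
      simp only [List.mem_append, List.mem_reverse]
      rintro x (hx | hx) <;> exact Term.ne_eq_of_mem_encode hx)
  have e1 : u.encode.reverse ++ t.encode.reverse ++ .eq :: R =
      u.encode.reverse ++ (t.encode.reverse ++ .eq :: R) := by simp
  have e2 : ((u.encode.reverse ++ t.encode.reverse).reverse.map .inl ++ I :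
      List (Tok A ⊕ Cert A)) = t.encode.map .inl ++ (u.encode.map .inl ++ I) := by simp
  rw [e1, e2] at h3
  have h4 := (h2.trans h3).trans (reach_merge .eq₃ (by simp) t m (u.encode.map .inl ++ I)
    (.eq :: R) X K)
  have h5 := h4.trans (reach_merge_last u (merge m t) I (t.encode.reverse ++ .eq :: R) X K)
  have hres : [t, u, t, u].foldl merge (T, none, acc) = merge (merge m t) u := rfl
  rw [← hres, merge_snd] at h5
  have e3 : ((Atom.eq t u).encode.map .inl ++ I : List (Tok A ⊕ Cert A)) =
      .inl .eq :: (t.encode.map .inl ++ (u.encode.map .inl ++ I)) := by simp [Atom.encode]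
  have e4 : (Atom.eq t u).encode.reverse ++ R =
      u.encode.reverse ++ (t.encode.reverse ++ .eq :: R) := by simp [Atom.encode]
  rw [e3, e4]
  -- Per symbol of the terms: two lookups at two steps each, and one step of `unread`; two further
  -- steps are constant.
  refine h5.mono ?_
  simp only [Atom.encode, List.length_append, List.length_singleton, List.length_reverse]
  omega

theorem reach_rel {n r : ℕ} (f : QF A r) (args : Fin r → Term A n) (acc : Bool)
    (I : List (Tok A ⊕ Cert A)) (R : List (Tok A)) (T : List (Val A)) (X : List A)
    (K : List Unit) :
    Reach inα inβ c (6 * (Atom.rel r f args).encode.length)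
      ⟨.atoms, .base c acc, .mk' ((Atom.rel r f args).encode.map .inl ++ I) R T X K⟩
      ⟨.atoms, .base c (acc || (Atom.rel r f args).refutes inα inβ c X T),
        .mk' I ((Atom.rel r f args).encode.reverse ++ R) T X K⟩ := by
  set l := List.ofFn args with hl
  have hlen : l.length = r := by simp [hl]
  set E := l.flatMap Term.encode with hE
  have h0 : Reach inα inβ c 1
      ⟨.atoms, .base c acc,
        .mk' (.inl .rel :: (E.map .inl ++ .inl .colon :: (f.encode.map .inl ++ .inl .close :: I)))
          R T X K⟩
      ⟨.args, .base c acc,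
        .mk' (E.map .inl ++ .inl .colon :: (f.encode.map .inl ++ .inl .close :: I))
          (.rel :: R) T X K⟩ :=
    reach_atoms _ _
  have h1 := h0.trans (reach_args_loop (.mk' I R T X K) l (.base c acc) rfl
    (.inl .colon :: (f.encode.map .inl ++ .inl .close :: I)) (.rel :: R) T X [])
  set k := tracks inα inβ (l.map fun t => (t.lookup T).join) with hk
  set k' := tracks inα inβ ((List.range r).map fun j => some (X.getD j c)) with hk'
  set r₁ : Reg A := ⟨none, c, c, k, k', false, false, acc⟩
  have h2 : Reach inα inβ c 1
      ⟨.args, r₁,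
        ⟨.inl .colon :: (f.encode.map .inl ++ .inl .close :: I), E.reverse ++ .rel :: R, T, [],
          X.drop r, (X.take r).reverse ++ [], [], K, []⟩⟩
      ⟨.restore, r₁,
        ⟨f.encode.map .inl ++ .inl .close :: I, .colon :: (E.reverse ++ .rel :: R), T, [],
          X.drop r, (X.take r).reverse ++ [], [], K, []⟩⟩ := by
    cases X.drop r <;> exact reach_args _ _
  rw [hlen] at h1
  have h3 := (h1.trans h2).trans (reach_restore_loop r₁
    ⟨f.encode.map .inl ++ .inl .close :: I, .colon :: (E.reverse ++ .rel :: R), T, [], [], [], [],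
      K, []⟩ (X.drop r) ((X.take r).reverse ++ []))
  have e0 : ((X.take r).reverse ++ []).reverse ++ X.drop r = X := by simp
  rw [e0] at h3
  have h4 := h3.trans (reach_form_run ⟨[], [], T, [], [], [], [], K, []⟩ f r₁ rfl rfl
    (.inl .close :: I) (.colon :: (E.reverse ++ .rel :: R)) X [])
  have h5 : Reach inα inβ c 1
      ⟨.form, r₁,
        ⟨.inl .close :: I, f.encode.reverse ++ .colon :: (E.reverse ++ .rel :: R), T, [],
          X, [], [f.val fun j => X.getD j c], K, []⟩⟩
      ⟨.atoms, .base c (acc || (Atom.rel r f args).refutes inα inβ c X T),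
        .mk' I (.close :: (f.encode.reverse ++ .colon :: (E.reverse ++ .rel :: R))) T X K⟩ := by
    cases X <;> exact reach_form _ _
  have e1 : ((Atom.rel r f args).encode.map .inl ++ I : List (Tok A ⊕ Cert A)) =
      .inl .rel :: (E.map .inl ++ .inl .colon :: (f.encode.map .inl ++ .inl .close :: I)) := by
    simp [Atom.encode, hE, hl]
  have e2 : (Atom.rel r f args).encode.reverse ++ R =
      .close :: (f.encode.reverse ++ .colon :: (E.reverse ++ .rel :: R)) := by
    simp [Atom.encode, hE, hl]
  rw [e1, e2]
  refine (h4.trans h5).mono ?_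
  -- Restoring the tuple takes at most one step per argument and one more, which the code of the
  -- arguments pays for.
  have h6 := length_le_flatMap_encode l
  rw [hlen, ← hE] at h6
  have h7 : (Atom.rel r f args).encode.length = E.length + f.encode.length + 3 := by
    simp [Atom.encode, hE, hl]
    omega
  have h8 : (X.take r).length ≤ r := List.length_take_le _ _
  rw [h7, ← hE]
  simp only [List.length_append, List.length_reverse, List.length_nil]
  omega

theorem reach_matrix {n : ℕ} (l : List (Atom A n)) (acc : Bool) (I : List (Tok A ⊕ Cert A))
    (R : List (Tok A)) (T : List (Val A)) (X : List A) (K : List Unit) :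
    Reach inα inβ c (6 * (l.flatMap Atom.encode).length)
      ⟨.atoms, .base c acc, .mk' ((l.flatMap Atom.encode).map .inl ++ I) R T X K⟩
      ⟨.atoms, .base c (l.foldl (atomStep inα inβ c X) (T, acc)).2,
        .mk' I ((l.flatMap Atom.encode).reverse ++ R)
          (l.foldl (atomStep inα inβ c X) (T, acc)).1 X K⟩ := by
  induction l generalizing acc R T with
  | nil => exact .refl _
  | cons a l ih =>
    have h1 : Reach inα inβ c (6 * a.encode.length)
        ⟨.atoms, .base c acc,
          .mk' (a.encode.map .inl ++ ((l.flatMap Atom.encode).map .inl ++ I)) R T X K⟩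
        ⟨.atoms, .base c (acc || a.refutes inα inβ c X T),
          .mk' ((l.flatMap Atom.encode).map .inl ++ I) (a.encode.reverse ++ R) (a.table T) X K⟩ := by
      cases a with
      | eq t u => exact reach_eq t u acc _ R T X K
      | rel r f args => exact reach_rel f args acc _ R T X K
    have h := h1.trans (ih (acc || a.refutes inα inβ c X T) (a.encode.reverse ++ R) (a.table T))
    have e1 : (((a :: l).flatMap Atom.encode).map .inl ++ I : List (Tok A ⊕ Cert A)) =
        a.encode.map .inl ++ ((l.flatMap Atom.encode).map .inl ++ I) := by simp
    have e2 : ((a :: l).flatMap Atom.encode).reverse ++ R =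
        (l.flatMap Atom.encode).reverse ++ (a.encode.reverse ++ R) := by simp
    rw [e1, e2]
    refine h.mono ?_
    simp only [List.flatMap_cons, List.length_append]
    omega

/-- The configuration before a round. -/
def Conf.start (c : A) (φ : Sentence A) (T : List (Val A)) (X : List A) (K : List Unit)
    (first acc : Bool) : Conf A :=
  ⟨.clock, { Reg.base c acc with first := first }, .mk' (φ.encode.map .inl) [] T X K⟩

theorem reach_round (φ : Sentence A) (T : List (Val A)) (X : List A) (K : List Unit)
    (first acc : Bool) :
    Reach inα inβ c (7 * φ.encode.length + 5) (.start c φ T X (() :: K) first acc)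
      (.start c φ (round inα inβ c X φ (resetIf first (List.ofFn φ.quant) T, acc)).1 X K false
        (round inα inβ c X φ (resetIf first (List.ofFn φ.quant) T, acc)).2) := by
  set qs := List.ofFn φ.quant with hqs
  have he : φ.encode = qs.map Quant.encode ++ φ.matrix.flatMap Atom.encode := rfl
  set M := φ.matrix.flatMap Atom.encode with hM
  have hlen : φ.encode.length = qs.length + M.length := by simp [he]
  have h0 : Reach inα inβ c 1 (.start c φ T X (() :: K) first acc)
      ⟨.quants, { Reg.base c acc with first := first },
        .mk' ((qs.map Quant.encode).map .inl ++ M.map .inl) [] T X K⟩ := by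
    have := reach_clock (inα := inα) (inβ := inβ) (c := c)
      { Reg.base c acc with first := first } (.mk' (φ.encode.map .inl) [] T X (() :: K))
    rw [← List.map_append, ← he]
    exact this
  have h1 := h0.trans (reach_quants_run (.mk' (φ.encode.map .inl) [] T X K) qs _ rfl (M.map .inl)
    (quant?_flatMap_encode φ.matrix) [] T)
  have hm := reach_matrix (inα := inα) (inβ := inβ) (c := c) φ.matrix
    (acc || openEx qs (resetIf first qs T)) [] ((qs.map Quant.encode).reverse ++ [])
    (resetIf first qs T) X K
  rw [List.append_nil (List.map _ _), ← hM] at hm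
  set m := φ.matrix.foldl (atomStep inα inβ c X)
    (resetIf first qs T, acc || openEx qs (resetIf first qs T)) with hmdef
  have h3 : Reach inα inβ c 1
      ⟨.atoms, .base c m.2, .mk' [] (M.reverse ++ ((qs.map Quant.encode).reverse ++ [])) m.1 X K⟩
      ⟨.rewind, .base c m.2, .mk' [] (M.reverse ++ ((qs.map Quant.encode).reverse ++ [])) m.1 X K⟩ :=
    reach_atoms _ _
  have h4 := reach_rewind_loop (inα := inα) (inβ := inβ) (c := c) (.base c m.2) (.mk' [] [] m.1 X K)
    [] (M.reverse ++ ((qs.map Quant.encode).reverse ++ []))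
  have e1 : ((M.reverse ++ ((qs.map Quant.encode).reverse ++ [])).reverse.map .inl ++ [] :
      List (Tok A ⊕ Cert A)) = φ.encode.map .inl := by
    rw [he]
    simp
  rw [e1] at h4
  refine (((h1.trans hm).trans h3).trans h4).mono ?_
  simp only [List.length_append, List.length_reverse, List.length_map, List.length_nil]
  omega

theorem reach_rounds (φ : Sentence A) (X : List A) (k : ℕ) (s : List (Val A) × Bool) :
    Reach inα inβ c ((7 * φ.encode.length + 5) * k)
      (.start c φ s.1 X (List.replicate k ()) false s.2)
      (.start c φ ((round inα inβ c X φ)^[k] s).1 X [] false ((round inα inβ c X φ)^[k] s).2) := by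
  induction k generalizing s with
  | zero => exact .refl _
  | succ k ih =>
    have h := reach_round (inα := inα) (inβ := inβ) (c := c) φ s.1 X (List.replicate k ()) false s.2
    exact (h.trans (ih (round inα inβ c X φ s))).mono (by rw [Nat.mul_succ]; omega)

theorem length_iterate_round (φ : Sentence A) (X : List A) (k : ℕ) (s : List (Val A) × Bool) :
    ((round inα inβ c X φ)^[k] s).1.length = s.1.length := by
  induction k generalizing s with
  | zero => rfl
  | succ k ih => rw [Function.iterate_succ_apply, ih, (Extends.round φ s).length_eq]

/-- The first round is special as it performs the reset. With no rounds at all the reset is omitted,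
which is harmless: only the flag and the length of the table matter afterwards. -/
theorem reach_all_rounds (φ : Sentence A) (T : List (Val A)) (X : List A) (k : ℕ) :
    ∃ T' first, Reach inα inβ c ((7 * φ.encode.length + 5) * k)
      (.start c φ T X (List.replicate k ()) true false)
      (.start c φ T' X [] first
        ((round inα inβ c X φ)^[k] (reset (List.ofFn φ.quant) T, false)).2) ∧
      T'.length = T.length := by
  cases k with
  | zero => exact ⟨T, true, .refl _, rfl⟩
  | succ k =>
    have h := reach_round (inα := inα) (inβ := inβ) (c := c) φ T X (List.replicate k ()) true false
    refine ⟨_, false, (h.trans (reach_rounds φ X k _)).mono (by rw [Nat.mul_succ]; omega), ?_⟩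
    rw [length_iterate_round, ← (Extends.round φ _).length_eq]
    exact length_reset _ _

/-! ### Loading and cleaning -/

theorem reach_load_tokens (r : Reg A) (s : Stacks A) (l : List (Tok A))
    (I : List (Tok A ⊕ Cert A)) (R : List (Tok A)) :
    Reach inα inβ c l.length ⟨.load, r, { s with inp := l.map .inl ++ I, rd := R }⟩
      ⟨.load, r, { s with inp := I, rd := l.reverse ++ R }⟩ := by
  induction l generalizing R with
  | nil => exact .refl _
  | cons t l ih =>
    have h := (reach_load (inα := inα) (inβ := inβ) (c := c) r
      { s with inp := (t :: l).map .inl ++ I, rd := R }).trans (ih (t :: R))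
    rw [List.reverse_cons, List.append_assoc]
    exact h.mono (by simp; omega)

/-- Loading onto stacks reverses the order of the symbols, hence the reversals in `verify`. -/
theorem reach_load_cert (r : Reg A) (s : Stacks A) (l : List (Cert A)) (T : List (Val A))
    (X : List A) (K : List Unit) :
    Reach inα inβ c (l.length + 1)
      ⟨.load, r, { s with inp := l.map .inr, tab := T, asg := X, clk := K }⟩
      ⟨.rewind, r, { s with
        inp := []
        tab := (l.filterMap Cert.entry?).reverse ++ T
        asg := (l.filterMap Cert.asg?).reverse ++ X
        clk := (l.filterMap Cert.tick?).reverse ++ K }⟩ := by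
  induction l generalizing T X K with
  | nil => exact reach_load r _
  | cons t l ih =>
    have h := reach_load (inα := inα) (inβ := inβ) (c := c) r
      { s with inp := (t :: l).map .inr, tab := T, asg := X, clk := K }
    cases t with
    | entry e =>
      have h' := h.trans (ih (e :: T) X K)
      simp only [List.filterMap_cons, Cert.entry?, Cert.asg?, Cert.tick?, List.reverse_cons,
        List.append_assoc]
      exact h'.mono (by simp; omega)
    | asg a =>
      have h' := h.trans (ih T (a :: X) K)
      simp only [List.filterMap_cons, Cert.entry?, Cert.asg?, Cert.tick?, List.reverse_cons,
        List.append_assoc]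
      exact h'.mono (by simp; omega)
    | tick =>
      have h' := h.trans (ih T X (() :: K))
      simp only [List.filterMap_cons, Cert.entry?, Cert.asg?, Cert.tick?, List.reverse_cons,
        List.append_assoc]
      exact h'.mono (by simp; omega)

/-- Each step removes a symbol from at least one of the three stacks. The other stacks are not
touched. -/
theorem reach_clean_loop (r : Reg A) (s : Stacks A) (m : ℕ) (I : List (Tok A ⊕ Cert A))
    (T : List (Val A)) (X : List A) (hm : I.length + T.length + X.length ≤ m) :
    Reach inα inβ c m ⟨.clean, r, { s with inp := I, tab := T, asg := X }⟩
      ⟨.clean, r, { s with inp := [], tab := [], asg := [] }⟩ := by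
  induction m generalizing I T X with
  | zero =>
    obtain ⟨rfl, rfl, rfl⟩ : I = [] ∧ T = [] ∧ X = [] := by
      refine ⟨List.length_eq_zero_iff.1 ?_, List.length_eq_zero_iff.1 ?_,
        List.length_eq_zero_iff.1 ?_⟩ <;> omega
    exact .refl _
  | succ m ih =>
    by_cases h : (I.head?.isSome || T.head?.isSome || X.head?.isSome) = true
    · have h1 := reach_clean (inα := inα) (inβ := inβ) (c := c) r
        { s with inp := I, tab := T, asg := X } h
      refine (h1.trans (ih I.tail T.tail X.tail ?_)).mono (by omega)
      cases I <;> cases T <;> cases X <;> simp at h hm ⊢ <;> omega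
    · obtain ⟨rfl, rfl, rfl⟩ : I = [] ∧ T = [] ∧ X = [] := by
        cases I <;> cases T <;> cases X <;> simp at h ⊢
      exact (Reach.refl _).mono (by omega)

theorem step_clean (r : Reg A) (sc : Scratch A) :
    Turing.TM2.step (prog inα inβ c) (Conf.toCfg ⟨.clean, r, .mk' [] [] [] [] []⟩ sc) =
      some ⟨none, (Reg.init c, ⟨none, none, none, none, none, none⟩),
        (⟨[], [], [], [], [], [], [], [], [r.acc]⟩ : Stacks A).get⟩ := by
  simp only [Conf.toCfg, Turing.TM2.step, prog, popInp, popTab, popAsg, stepAux, goto,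
    Stacks.update_inp, Stacks.update_tab, Stacks.update_asg, Stacks.update_out]
  rfl

/-- The complete run of the machine. -/
theorem reach_clean_of_load (φ : Sentence A) (w : List (Cert A)) :
    ∃ r : Reg A, r.acc = verify inα inβ c (φ, w) ∧
      Reach inα inβ c (7 * (φ.encode.length + w.length) ^ 2 + 10 * (φ.encode.length + w.length) + 5)
        ⟨.load, .init c, .mk' (encodeWithCert Sentence.encode (φ, w)) [] [] [] []⟩
        ⟨.clean, r, .mk' [] [] [] [] []⟩ := by
  set T := (w.filterMap Cert.entry?).reverse with hT
  set X := (w.filterMap Cert.asg?).reverse with hX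
  set k := (w.filterMap Cert.tick?).length with hk
  have hK : (w.filterMap Cert.tick?).reverse = List.replicate k () :=
    List.eq_replicate_iff.2 ⟨by simp [hk], by simp⟩
  have h1 := reach_load_tokens (inα := inα) (inβ := inβ) (c := c) (.init c) (.mk' [] [] [] [] [])
    φ.encode (w.map .inr) []
  have h2 := h1.trans (reach_load_cert (.init c) (.mk' [] (φ.encode.reverse ++ []) [] [] []) w
    [] [] [])
  have h3 := h2.trans (reach_rewind_loop (.init c)
    (.mk' [] [] ((w.filterMap Cert.entry?).reverse ++ []) ((w.filterMap Cert.asg?).reverse ++ [])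
      ((w.filterMap Cert.tick?).reverse ++ [])) [] (φ.encode.reverse ++ []))
  simp only [List.append_nil, List.reverse_reverse, ← hT, ← hX, hK] at h3
  obtain ⟨T', first, h4, hT'⟩ := reach_all_rounds (inα := inα) (inβ := inβ) (c := c) φ T X k
  have h5 := h3.trans h4
  have h6 := h5.trans (reach_clock _ _)
  refine ⟨_, rfl, (h6.trans (reach_clean_loop _ (.mk' [] [] [] [] []) _ (φ.encode.map .inl) T' X
    le_rfl)).mono ?_⟩
  have hlT : T'.length ≤ w.length := by
    rw [hT', hT, List.length_reverse]; exact List.length_filterMap_le _ _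
  have hlX : X.length ≤ w.length := by
    rw [hX, List.length_reverse]; exact List.length_filterMap_le _ _
  have hlk : k ≤ w.length := List.length_filterMap_le _ _
  simp only [List.length_map, List.length_reverse]
  -- The quadratic term comes from the rounds: at most `w.length` of them, each linear in the code
  -- of `φ`.
  nlinarith
end

/-! ### Membership in co-NP -/

section
variable [Finite A] [DecidableEq A] (inα inβ : A → Bool) (c : A)

noncomputable def verifier : Turing.FinTM2 :=
  letI : Fintype Label := Fintype.ofFinite _
  letI : Fintype (Reg A × Scratch A) := Fintype.ofFinite _
  letI : Fintype (Stack.Symbol A .inp) := Fintype.ofFinite (Tok A ⊕ Cert A)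
  { K := Stack
    k₀ := .inp
    k₁ := .out
    Γ := Stack.Symbol A
    Λ := Label
    main := .load
    σ := Reg A × Scratch A
    initialState := (.init c, ⟨none, none, none, none, none, none⟩)
    m := prog inα inβ c }

theorem initList_verifier (l : List (Tok A ⊕ Cert A)) :
    Turing.initList (verifier inα inβ c) l =
      Conf.toCfg ⟨.load, .init c, .mk' l [] [] [] []⟩ ⟨none, none, none, none, none, none⟩ := by
  refine congrArg (Turing.TM2.Cfg.mk _ _) ?_
  funext k
  cases k <;> rfl

theorem haltList_verifier (l : List Bool) :
    Turing.haltList (verifier inα inβ c) l =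
      ⟨none, (Reg.init c, ⟨none, none, none, none, none, none⟩),
        (⟨[], [], [], [], [], [], [], [], l⟩ : Stacks A).get⟩ := by
  refine congrArg (Turing.TM2.Cfg.mk _ _) ?_
  funext k
  cases k <;> rfl

theorem verifier_outputs (x : Sentence A × List (Cert A)) :
    ∃ n ≤ 7 * (encodeWithCert Sentence.encode x).length ^ 2 +
        10 * (encodeWithCert Sentence.encode x).length + 6,
      (flip bind (verifier inα inβ c).step)^[n]
          (some (Turing.initList (verifier inα inβ c) (encodeWithCert Sentence.encode x))) =
        some (Turing.haltList (verifier inα inβ c) [verify inα inβ c x]) := by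
  obtain ⟨φ, w⟩ := x
  obtain ⟨r, hr, h⟩ := reach_clean_of_load (inα := inα) (inβ := inβ) (c := c) φ w
  obtain ⟨s', m, hm, h⟩ := h ⟨none, none, none, none, none, none⟩
  have hlen : (encodeWithCert Sentence.encode (φ, w)).length = φ.encode.length + w.length := by
    simp [encodeWithCert]
  refine ⟨m + 1, by rw [hlen]; omega, ?_⟩
  rw [← hr]
  exact (congrArg (fun x => (flip bind (Turing.TM2.step (prog inα inβ c)))^[m + 1] (some x))
    (initList_verifier inα inβ c _)).trans ((Function.iterate_succ_apply' _ m _).trans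
      ((congrArg (flip bind (Turing.TM2.step (prog inα inβ c))) h).trans ((step_clean r s').trans
        (congrArg some (haltList_verifier inα inβ c [r.acc]).symm))))

theorem verify_computableInPolyTime :
    Nonempty (Turing.TM2ComputableInPolyTime (encodeWithCert (Sentence.encode (A := A)))
      Computability.encodeBool (verify inα inβ c)) := by
  refine ⟨{
    tm := verifier inα inβ c
    inputAlphabet := Equiv.refl _
    outputAlphabet := Equiv.refl _
    time := 7 * Polynomial.X ^ 2 + 10 * Polynomial.X + 6
    outputsFun := fun x =>
      { steps := (verifier_outputs inα inβ c x).choose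
        evals_in_steps := ?_
        steps_le_m := ?_ } }⟩
  · have h := (verifier_outputs inα inβ c x).choose_spec.2
    have h1 : (encodeWithCert Sentence.encode x).map (Equiv.refl (Tok A ⊕ Cert A)).invFun =
      encodeWithCert Sentence.encode x := List.map_id _
    exact (congrArg (fun l => (flip bind (verifier inα inβ c).step)^[_]
      (some (Turing.initList (verifier inα inβ c) l))) h1).trans h
  · simpa using (verifier_outputs inα inβ c x).choose_spec.1

end

open Classical in
theorem inCoNP_qcsp [Finite A] [Nontrivial A] {α β : Set A} {c : A} (hc : c ∈ α ∩ β) :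
    InCoNP (Sentence.encode (A := A)) (QCSP (tauLanguage α β)) := by
  have hα : ∀ a, decide (a ∈ α) = true ↔ a ∈ α := fun a => decide_eq_true_iff
  have hβ : ∀ a, decide (a ∈ β) = true ↔ a ∈ β := fun a => decide_eq_true_iff
  refine ⟨Cert A, inferInstance, verify (fun a => decide (a ∈ α)) (fun a => decide (a ∈ β)) c,
    3 * Polynomial.X + 1, verify_computableInPolyTime _ _ c, fun φ => ⟨fun h => ?_, ?_⟩⟩
  · contrapose! h
    refine qcsp_of_verify_eq_false hα hβ hc fun w hw => ?_
    simpa using h w (by simpa using hw)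
  · rintro ⟨w, -, hw⟩ h
    simp [verify_eq_false hα hβ h w] at hw

end PH

theorem mainTheorem9 {A : Type} [Finite A] [DecidableEq A] (α β : Set A)
    (hα : α ≠ Set.univ) (hβ : β ≠ Set.univ) (hunion : α ∪ β = Set.univ)
    (hinter : (α ∩ β).Nonempty) :
    PH.InCoNP (PH.Sentence.encode (A := A)) (PH.QCSP (PH.tauLanguage α β)) ∧
    (∀ φ : PH.Sentence A, φ.Over (PH.tauLanguage α β) → (∀ a ∈ φ.matrix, ¬ a.IsVarEq) →
      φ.elimConst.Over (PH.tauLanguage α β) ∧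
      (φ.IsTrue ↔ (∀ a ∈ φ.elimConst.matrix, ¬ a.IsEq) ∧ φ.elimConst.IsTrue)) ∧
    (∀ φ : PH.Sentence A, φ.Over (PH.tauLanguage α β) → (∀ a ∈ φ.matrix, ¬ a.IsEq) →
      ∀ c ∈ α ∩ β, (φ.IsTrue ↔ (φ.instantiate c).IsTrue)) := by
  obtain ⟨c, hc⟩ := hinter
  obtain ⟨a, ha⟩ := (Set.ne_univ_iff_exists_notMem α).1 hα
  -- An element outside `α` and one in `α ∩ β` differ; two elements are what makes fixing a
  -- universal variable to a constant refutable.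
  have : Nontrivial A := ⟨a, c, fun h => ha (h ▸ hc.1)⟩
  exact ⟨PH.inCoNP_qcsp hc, fun φ hover hφ => ⟨hover.elimConst, φ.isTrue_iff_elimConst hφ⟩,
    fun φ hover hφ c hc => φ.isTrue_iff_instantiate hover hφ hc⟩
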